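/- \textbf{Conventions.} A \emph{dynamical system} $(Y,f)$ is a continuous map $f:Y\to Y$ on a metric space $(Y,\rho)$. For $\varepsilon>0$, a set $S\subset Y$ is \emph{Li-Yorke $\varepsilon$-scrambled} if for all distinct $x,y\in S$ $$\limsup_{n\to\infty}\rho(f^n(x),f^n(y))\ge\varepsilon\quad\text{and}\quad\liminf_{n\to\infty}\rho(f^n(x),f^n(y))=0,$$ where the limsup is allowed to be $+\infty$. The system is \emph{uniformly Li-Yorke chaotic} if for some $\varepsilon>0$ it has an uncountable Li-Yorke $\varepsilon$-scrambled set. It is \emph{Cantor-densely Li-Yorke chaotic} if there is $\varepsilon>0$ such that for every sequence $(U_j)_{j\in\mathbb N}$ of non-empty open subsets of $Y$ there are sets $K_j\subset U_j$, each homeomorphic to the Cantor ternary set, such that $\bigcup_{j}K_j$ is Li-Yorke $\varepsilon$-scrambled. Let $(X,d)$ be a metric space, $f:X\to X$ a continuous map and $\mathbb I=[0,1]$. $\mathcal K(X)$ is the set of non-empty compact subsets of $X$ with the Hausdorff metric $d_H$, and $\overline f(K)=f(K)$. For $u:X\to\mathbb I$ put $u_\alpha=\{x: u(x)\ge\alpha\}$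 for $\alpha\in(0,1]$ and $u_0=\overline{\{x:u(x)>0\}}$. $\mathcal F(X)$ is the set of upper semicontinuous $u:X\to\mathbb I$ with $u_0$ compact and $u_1\neq\varnothing$, and $[\hat f(u)](x)=\sup\{u(y): f(y)=x\}$ (with $\sup\varnothing=0$). Consider on $\mathcal F(X)$ the metrics $$d_\infty(u,v)=\sup_{\alpha\in\mathbb I}d_H(u_\alpha,v_\alpha),$$ $$d_0(u,v)=\inf\Big\{\varepsilon>0:\ \exists\,\xi\in\mathcal T,\ \sup_{\alpha\in\mathbb I}|\xi(\alpha)-\alpha|\le\varepsilon,\ d_\infty(u,\xi\circ v)\le\varepsilon\Big\},$$ where $\mathcal T$ is the set of strictly increasing homeomorphisms of $\mathbb I$, and, with $X\times\mathbb I$ carrying the maximum metric, $d_E(u,v)$ and $d_S(u,v)$ are the Hausdorff distances between $\operatorname{end}(u)$ and $\operatorname{end}(v)$, respectively between $\operatorname{send}(u)$ and $\operatorname{send}(v)$, where $\operatorname{end}(u)=\{(x,\alpha)\in X\times\mathbb I:u(x)\ge\alpha\}$ and $\operatorname{send}(u)=\operatorname{end}(u)\cap(u_0\times\mathbb I)$.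 Write $\mathcal F_\infty(X),\mathcal F_0(X),\mathcal F_S(X),\mathcal F_E(X)$ for $\mathcal F(X)$ with $d_\infty,d_0,d_S,d_E$ respectively. \textbf{Corollary (hypercyclic operators).} Let $X\neq\{0\}$ be a real or complex Fréchet space, that is, a locally convex topological vector space whose topology is given by a complete translation-invariant metric $d$, fixed from now on. Let $T:X\to X$ be a continuous linear operator that is hypercyclic, i.e. such that $\{T^n(x):n\ge 0\}$ is dense in $X$ for some $x\in X$. Then the dynamical systems $(\mathcal K(X),\overline T)$ (for $d_H$), $(\mathcal F_\infty(X),\hat T)$ and $(\mathcal F_0(X),\hat T)$ are Cantor-densely Li-Yorke chaotic, and the dynamical systems $(\mathcal F_S(X),\hat T)$ and $(\mathcal F_E(X),\hat T)$ are uniformly Li-Yorke chaotic. -/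

import Mathlib

open Set Filter Topology Metric unitInterval

namespace FuzzyChaos

/-! ### Li-Yorke chaos on metric spaces -/

section Chaos

variable {Y : Type*}

/-- `(x, y)` is a Li-Yorke `ε`-pair for `f` and the metric `m`:
`limsup d(fⁿ x, fⁿ y) ≥ ε` and `liminf d(fⁿ x, fⁿ y) = 0`. The limits are taken in the extended
reals, since the distances along the orbits need not be bounded. -/
def IsLiYorkePair (m : MetricSpace Y) (f : Y → Y) (ε : ℝ) (x y : Y) : Prop :=
  (ε : EReal) ≤ limsup (fun n : ℕ => ((dist (f^[n] x) (f^[n] y) : ℝ) : EReal)) atTop ∧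
    liminf (fun n : ℕ => ((dist (f^[n] x) (f^[n] y) : ℝ) : EReal)) atTop = 0

/-- Every pair of distinct points of `S` is a Li-Yorke `ε`-pair. -/
def IsLiYorkeScrambled (m : MetricSpace Y) (f : Y → Y) (ε : ℝ) (S : Set Y) : Prop :=
  ∀ x ∈ S, ∀ y ∈ S, x ≠ y → IsLiYorkePair m f ε x y

/-- The dynamical system `(Y, f)` (a continuous map on a metric space) is uniformly Li-Yorke
chaotic for the metric `m`. -/
def UniformlyLiYorkeChaotic (m : MetricSpace Y) (f : Y → Y) : Prop :=
  Continuous f ∧ ∃ ε : ℝ, 0 < ε ∧ ∃ S : Set Y, ¬ S.Countable ∧ IsLiYorkeScrambled m f ε S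

/-- A set homeomorphic to the ternary Cantor set. -/
def IsCantorSet [TopologicalSpace Y] (K : Set Y) : Prop :=
  Nonempty (K ≃ₜ cantorSet)

/-- The dynamical system `(Y, f)` (a continuous map on a metric space) is Cantor-densely Li-Yorke
chaotic for the metric `m`. -/
def CantorDenselyLiYorkeChaotic (m : MetricSpace Y) (f : Y → Y) : Prop :=
  Continuous f ∧ ∃ ε : ℝ, 0 < ε ∧
    ∀ U : ℕ → Set Y, (∀ j, IsOpen (U j) ∧ (U j).Nonempty) →
      ∃ K : ℕ → Set Y, (∀ j, IsCantorSet (K j) ∧ K j ⊆ U j) ∧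
        IsLiYorkeScrambled m f ε (⋃ j, K j)

end Chaos

/-! ### Normal fuzzy sets -/

section Levels

variable {X : Type*} [TopologicalSpace X]

/-- The `α`-level of a fuzzy set `u : X → [0, 1]`. -/
def level (u : X → I) (α : I) : Set X :=
  if α = 0 then closure {x | 0 < u x} else {x | α ≤ u x}

/-- The endograph of a fuzzy set. -/
def endograph (u : X → I) : Set (X × I) := {p | p.2 ≤ u p.1}

/-- The sendograph of a fuzzy set. -/
def sendograph (u : X → I) : Set (X × I) := endograph u ∩ (level u 0 ×ˢ univ)

end Levels

/-- Normal fuzzy sets: upper semicontinuous functions `u : X → [0, 1]` whose `0`-level is compact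
and whose `1`-level is non-empty. -/
structure FuzzySet (X : Type*) [TopologicalSpace X] where
  toFun : X → I
  usc : UpperSemicontinuous toFun
  compact : IsCompact (level toFun 0)
  normal : (level toFun 1).Nonempty

namespace FuzzySet

section Basic

variable {X : Type*} [TopologicalSpace X]

theorem ext_fun {u v : FuzzySet X} (h : u.toFun = v.toFun) : u = v := by
  cases u; cases v; cases h; rfl

theorem level_zero (u : X → I) : level u 0 = closure {x | 0 < u x} := by simp [level]

theorem level_pos (u : X → I) {α : I} (h : α ≠ 0) : level u α = {x | α ≤ u x} := by
  simp [level, h]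

theorem mem_level_zero {u : X → I} {x : X} (h : 0 < u x) : x ∈ level u 0 := by
  rw [level_zero]; exact subset_closure h

theorem level_subset (u : X → I) (α : I) : level u α ⊆ level u 0 := by
  by_cases h : α = 0
  · rw [h]
  · rw [level_pos u h]
    intro x hx
    exact mem_level_zero (lt_of_lt_of_le (unitInterval.pos_iff_ne_zero.2 h) hx)

theorem exists_eq_one (u : FuzzySet X) : ∃ x, u.toFun x = 1 := by
  obtain ⟨x, hx⟩ := u.normal
  rw [level_pos _ one_ne_zero] at hx
  exact ⟨x, le_antisymm unitInterval.le_one' hx⟩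

theorem level_nonempty (u : FuzzySet X) (α : I) : (level u.toFun α).Nonempty := by
  obtain ⟨x, hx⟩ := u.exists_eq_one
  refine ⟨x, ?_⟩
  by_cases h : α = 0
  · rw [h]; exact mem_level_zero (by rw [hx]; exact zero_lt_one)
  · rw [level_pos _ h]
    change α ≤ u.toFun x
    rw [hx]; exact unitInterval.le_one'

theorem level_isClosed (u : FuzzySet X) (α : I) : IsClosed (level u.toFun α) := by
  by_cases h : α = 0
  · rw [h, level_zero]; exact isClosed_closure
  · rw [level_pos _ h]; exact u.usc.isClosed_preimage α

theorem level_isCompact (u : FuzzySet X) (α : I) : IsCompact (level u.toFun α) :=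
  u.compact.of_isClosed_subset (u.level_isClosed α) (level_subset _ α)

theorem eq_of_level {u v : FuzzySet X} (h : ∀ α, level u.toFun α = level v.toFun α) : u = v := by
  have key : ∀ {u v : FuzzySet X}, (∀ α, level u.toFun α = level v.toFun α) →
      ∀ x, u.toFun x ≤ v.toFun x := by
    intro u v h x
    by_cases h0 : u.toFun x = 0
    · rw [h0]; exact unitInterval.nonneg'
    · have := h (u.toFun x)
      rw [level_pos _ h0, level_pos _ h0] at this
      have hx : x ∈ {y | u.toFun x ≤ u.toFun y} := by change u.toFun x ≤ u.toFun x; exact le_rfl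
      rw [this] at hx
      exact hx
  exact ext_fun (funext fun x => le_antisymm (key h x) (key (fun α => (h α).symm) x))

theorem endograph_isClosed (u : FuzzySet X) : IsClosed (endograph u.toFun) :=
  u.usc.IsClosed_hypograph

theorem eq_of_endograph {u v : FuzzySet X} (h : endograph u.toFun = endograph v.toFun) :
    u = v := by
  refine ext_fun (funext fun x => le_antisymm ?_ ?_)
  · have : (x, u.toFun x) ∈ endograph u.toFun := le_refl (u.toFun x)
    rw [h] at this; exact this
  · have : (x, v.toFun x) ∈ endograph v.toFun := le_refl (v.toFun x)
    rw [← h] at this; exact this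

theorem sendograph_isClosed (u : FuzzySet X) : IsClosed (sendograph u.toFun) :=
  u.endograph_isClosed.inter ((u.level_isClosed 0).prod isClosed_univ)

theorem sendograph_isCompact (u : FuzzySet X) : IsCompact (sendograph u.toFun) :=
  (u.compact.prod isCompact_univ).of_isClosed_subset u.sendograph_isClosed inter_subset_right

theorem sendograph_nonempty (u : FuzzySet X) : (sendograph u.toFun).Nonempty := by
  obtain ⟨x, hx⟩ := u.level_nonempty 0
  exact ⟨(x, 0), unitInterval.nonneg', hx, mem_univ _⟩

theorem eq_of_sendograph {u v : FuzzySet X} (h : sendograph u.toFun = sendograph v.toFun) :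
    u = v := by
  have key : ∀ {u v : FuzzySet X}, sendograph u.toFun = sendograph v.toFun →
      ∀ x, u.toFun x ≤ v.toFun x := by
    intro u v h x
    by_cases h0 : u.toFun x = 0
    · rw [h0]; exact unitInterval.nonneg'
    · have : (x, u.toFun x) ∈ sendograph u.toFun :=
        ⟨le_refl (u.toFun x), mem_level_zero (unitInterval.pos_iff_ne_zero.2 h0), mem_univ _⟩
      rw [h] at this
      exact this.1
  exact ext_fun (funext fun x => le_antisymm (key h x) (key h.symm x))

theorem level_comp (ξ : I ≃o I) (u : X → I) (α : I) :
    level (ξ ∘ u) α = level u (ξ.symm α) := by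
  have h0 : ξ 0 = 0 := ξ.map_bot
  by_cases h : α = 0
  · have : ξ.symm 0 = 0 := ξ.symm.map_bot
    rw [h, this, level_zero, level_zero]
    congr 1
    ext x
    change 0 < ξ (u x) ↔ 0 < u x
    rw [← h0, ξ.lt_iff_lt, h0]
  · have : ξ.symm α ≠ 0 := fun h' => h (by rw [← h0, ← h', ξ.apply_symm_apply])
    rw [level_pos _ h, level_pos _ this]
    ext x
    exact (ξ.symm_apply_le).symm

/-- The normal fuzzy set `ξ ∘ u`, for a strictly increasing homeomorphism `ξ` of `[0, 1]` (that is,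
an order isomorphism of `[0, 1]` with itself). -/
def reparam (ξ : I ≃o I) (u : FuzzySet X) : FuzzySet X where
  toFun := ξ ∘ u.toFun
  usc := ξ.continuous.comp_upperSemicontinuous u.usc ξ.monotone
  compact := by rw [level_comp]; exact u.level_isCompact _
  normal := by rw [level_comp]; exact u.level_nonempty _

end Basic

/-! ### Zadeh extension -/

section Zadeh

variable {X : Type*}

/-- The Zadeh extension of `f` on functions `X → [0, 1]`; the supremum over an empty fibre is `0`,
the least element of `[0, 1]`. -/
noncomputable def zadehFun (f : X → X) (u : X → I) : X → I :=
  fun x => sSup (u '' (f ⁻¹' {x}))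

theorem zadehFun_of_empty (f : X → X) (u : X → I) (x : X) (h : f ⁻¹' {x} = ∅) :
    zadehFun f u x = 0 := by
  rw [zadehFun, h, image_empty, sSup_empty]; rfl

theorem zadehFun_support (f : X → X) (u : X → I) :
    {x | 0 < zadehFun f u x} = f '' {x | 0 < u x} := by
  ext x
  simp only [mem_ofPred_eq, zadehFun, lt_sSup_iff, mem_image, mem_preimage, mem_singleton_iff]
  constructor
  · rintro ⟨_, ⟨y, hy, rfl⟩, h⟩; exact ⟨y, h, hy⟩
  · rintro ⟨y, h, hy⟩; exact ⟨_, ⟨y, hy, rfl⟩, h⟩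

variable [TopologicalSpace X]

theorem level_zadehFun [T2Space X] {f : X → X} (hf : Continuous f) (u : FuzzySet X) (α : I) :
    level (zadehFun f u.toFun) α = f '' level u.toFun α := by
  by_cases h : α = 0
  · rw [h, level_zero, zadehFun_support, level_zero]
    have hc : IsCompact (closure {x | 0 < u.toFun x}) := by rw [← level_zero]; exact u.compact
    exact (closure_image_closure hf ▸ (hc.image hf).isClosed.closure_eq.symm ▸ rfl)
  · rw [level_pos _ h, level_pos _ h]
    ext x
    constructor
    · intro hx
      have hpos : 0 < α := unitInterval.pos_iff_ne_zero.2 h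
      have hx' : 0 < zadehFun f u.toFun x := lt_of_lt_of_le hpos hx
      have : x ∈ f '' {x | 0 < u.toFun x} := by rw [← zadehFun_support]; exact hx'
      obtain ⟨y, hy, hyx⟩ := this
      have hC : IsCompact (level u.toFun 0 ∩ f ⁻¹' {x}) :=
        u.compact.inter_right (isClosed_singleton.preimage hf)
      obtain ⟨z, hz, hmax⟩ := UpperSemicontinuousOn.exists_isMaxOn
        (⟨y, mem_level_zero hy, hyx⟩ : (level u.toFun 0 ∩ f ⁻¹' {x}).Nonempty) hC
        (u.usc.upperSemicontinuousOn _)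
      have hx2 : α ≤ zadehFun f u.toFun x := hx
      have hz2 : zadehFun f u.toFun x ≤ u.toFun z := by
        refine sSup_le ?_
        rintro _ ⟨w, hw, rfl⟩
        by_cases hw0 : u.toFun w = 0
        · rw [hw0]; exact unitInterval.nonneg'
        · exact hmax ⟨mem_level_zero (unitInterval.pos_iff_ne_zero.2 hw0), hw⟩
      refine ⟨z, ?_, hz.2⟩
      change α ≤ u.toFun z
      exact hx2.trans hz2
    · rintro ⟨y, hy, rfl⟩
      have hy2 : α ≤ u.toFun y := hy
      change α ≤ zadehFun f u.toFun (f y)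
      exact hy2.trans (le_sSup ⟨y, rfl, rfl⟩)

/-- The Zadeh extension of a continuous map, acting on normal fuzzy sets. -/
noncomputable def zadeh [T2Space X] (f : X → X) (hf : Continuous f) (u : FuzzySet X) :
    FuzzySet X where
  toFun := zadehFun f u.toFun
  usc := by
    rw [upperSemicontinuous_iff_isClosed_preimage]
    intro α
    by_cases h : α = 0
    · have : zadehFun f u.toFun ⁻¹' Ici α = univ := by
        rw [h]; exact eq_univ_of_forall fun x => unitInterval.nonneg'
      rw [this]; exact isClosed_univ
    · have : zadehFun f u.toFun ⁻¹' Ici α = f '' level u.toFun α := by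
        rw [← level_zadehFun hf, level_pos _ h]; rfl
      rw [this]; exact ((u.level_isCompact α).image hf).isClosed
  compact := by rw [level_zadehFun hf]; exact u.compact.image hf
  normal := by rw [level_zadehFun hf]; exact (u.level_nonempty 1).image f

end Zadeh

/-! ### The four metrics on the space of normal fuzzy sets -/

section Metrics

variable {X : Type*} [MetricSpace X]

/-- The supremum distance: the supremum of the Hausdorff distances of the levels. -/
noncomputable def distSup (u v : FuzzySet X) : ℝ :=
  ⨆ α : I, hausdorffDist (level u.toFun α) (level v.toFun α)

/-- The Skorokhod distance. -/
noncomputable def distSkorokhod (u v : FuzzySet X) : ℝ :=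
  sInf {ε : ℝ | 0 < ε ∧ ∃ ξ : I ≃o I,
    (⨆ α : I, |(ξ α : ℝ) - (α : ℝ)|) ≤ ε ∧ distSup u (reparam ξ v) ≤ ε}

/-- The sendograph distance. The metric on `X × [0, 1]` is the maximum metric. -/
noncomputable def distSend (u v : FuzzySet X) : ℝ :=
  hausdorffDist (sendograph u.toFun) (sendograph v.toFun)

/-- The endograph distance. The metric on `X × [0, 1]` is the maximum metric. -/
noncomputable def distEnd (u v : FuzzySet X) : ℝ :=
  hausdorffDist (endograph u.toFun) (endograph v.toFun)

theorem level_edist_ne_top (u v : FuzzySet X) (α β : I) :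
    hausdorffEDist (level u.toFun α) (level v.toFun β) ≠ ⊤ :=
  hausdorffEDist_ne_top_of_nonempty_of_bounded (u.level_nonempty α) (v.level_nonempty β)
    (u.level_isCompact α).isBounded (v.level_isCompact β).isBounded

theorem distSup_bdd (u v : FuzzySet X) :
    BddAbove (range fun α : I => hausdorffDist (level u.toFun α) (level v.toFun α)) := by
  refine ⟨diam (level u.toFun 0 ∪ level v.toFun 0), ?_⟩
  rintro _ ⟨α, rfl⟩
  refine (hausdorffDist_le_diam (u.level_nonempty α) (u.level_isCompact α).isBounded
    (v.level_nonempty α) (v.level_isCompact α).isBounded).trans ?_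
  exact diam_mono (union_subset_union (level_subset _ α) (level_subset _ α))
    (u.compact.isBounded.union v.compact.isBounded)

theorem le_distSup (u v : FuzzySet X) (α : I) :
    hausdorffDist (level u.toFun α) (level v.toFun α) ≤ distSup u v :=
  le_ciSup (distSup_bdd u v) α

theorem distSup_self (u : FuzzySet X) : distSup u u = 0 := by simp [distSup]

theorem distSup_comm (u v : FuzzySet X) : distSup u v = distSup v u := by
  simp only [distSup, hausdorffDist_comm]

theorem distSup_nonneg (u v : FuzzySet X) : 0 ≤ distSup u v :=
  hausdorffDist_nonneg.trans (le_distSup u v 0)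

theorem distSup_triangle (u v w : FuzzySet X) : distSup u w ≤ distSup u v + distSup v w :=
  ciSup_le fun α => (hausdorffDist_triangle (level_edist_ne_top u v α α)).trans
    (add_le_add (le_distSup u v α) (le_distSup v w α))

theorem eq_of_distSup {u v : FuzzySet X} (h : distSup u v = 0) : u = v :=
  eq_of_level fun α => ((u.level_isClosed α).hausdorffDist_zero_iff_eq (v.level_isClosed α)
    (level_edist_ne_top u v α α)).1 (le_antisymm (h ▸ le_distSup u v α) hausdorffDist_nonneg)

theorem distSup_reparam (ξ : I ≃o I) (u v : FuzzySet X) :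
    distSup (reparam ξ u) (reparam ξ v) = distSup u v := by
  simp only [distSup, reparam, level_comp]
  exact ξ.symm.surjective.iSup_comp
    (g := fun α => hausdorffDist (level u.toFun α) (level v.toFun α))

theorem reparam_symm (ξ : I ≃o I) (u : FuzzySet X) : reparam ξ (reparam ξ.symm u) = u :=
  ext_fun (funext fun _ => ξ.apply_symm_apply _)

theorem shift_bdd (ξ : I ≃o I) : BddAbove (range fun α : I => |(ξ α : ℝ) - (α : ℝ)|) := by
  refine ⟨1, ?_⟩
  rintro _ ⟨α, rfl⟩
  have h1 := (ξ α).2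
  have h2 := α.2
  exact abs_le.2 ⟨by linarith [h1.1, h2.2], by linarith [h1.2, h2.1]⟩

theorem le_shift (ξ : I ≃o I) (α : I) :
    |(ξ α : ℝ) - (α : ℝ)| ≤ ⨆ α : I, |(ξ α : ℝ) - (α : ℝ)| :=
  le_ciSup (shift_bdd ξ) α

theorem skorokhod_bdd (u v : FuzzySet X) :
    BddBelow {ε : ℝ | 0 < ε ∧ ∃ ξ : I ≃o I,
      (⨆ α : I, |(ξ α : ℝ) - (α : ℝ)|) ≤ ε ∧ distSup u (reparam ξ v) ≤ ε} :=
  ⟨0, fun _ h => h.1.le⟩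

theorem skorokhod_nonempty (u v : FuzzySet X) :
    {ε : ℝ | 0 < ε ∧ ∃ ξ : I ≃o I,
      (⨆ α : I, |(ξ α : ℝ) - (α : ℝ)|) ≤ ε ∧ distSup u (reparam ξ v) ≤ ε}.Nonempty := by
  have h := distSup_nonneg u v
  refine ⟨distSup u v + 1, by linarith, OrderIso.refl I, ?_, ?_⟩
  · simp; linarith
  · have : reparam (OrderIso.refl I) v = v := ext_fun rfl
    rw [this]; linarith

theorem distSkorokhod_nonneg (u v : FuzzySet X) : 0 ≤ distSkorokhod u v :=
  Real.sInf_nonneg fun _ h => h.1.le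

theorem exists_of_distSkorokhod_lt {u v : FuzzySet X} {ε : ℝ} (h : distSkorokhod u v < ε) :
    ∃ ξ : I ≃o I, (∀ α : I, |(ξ α : ℝ) - (α : ℝ)| ≤ ε) ∧ distSup u (reparam ξ v) ≤ ε := by
  obtain ⟨δ, ⟨_, ξ, h1, h2⟩, hδ⟩ := (csInf_lt_iff (skorokhod_bdd u v) (skorokhod_nonempty u v)).1 h
  exact ⟨ξ, fun α => ((le_shift ξ α).trans h1).trans hδ.le, h2.trans hδ.le⟩

theorem distSkorokhod_le {u v : FuzzySet X} {ε : ℝ} (hε : 0 < ε) (ξ : I ≃o I)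
    (h1 : ∀ α : I, |(ξ α : ℝ) - (α : ℝ)| ≤ ε) (h2 : distSup u (reparam ξ v) ≤ ε) :
    distSkorokhod u v ≤ ε :=
  csInf_le (skorokhod_bdd u v) ⟨hε, ξ, ciSup_le h1, h2⟩

theorem distSkorokhod_self (u : FuzzySet X) : distSkorokhod u u = 0 := by
  refine le_antisymm (le_of_forall_pos_le_add fun ε hε => ?_) (distSkorokhod_nonneg u u)
  rw [zero_add]
  refine distSkorokhod_le hε (OrderIso.refl I) (fun α => by simpa using hε.le) ?_
  have : reparam (OrderIso.refl I) u = u := ext_fun rfl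
  rw [this, distSup_self]; exact hε.le

theorem distSkorokhod_comm_le (u v : FuzzySet X) : distSkorokhod u v ≤ distSkorokhod v u := by
  refine le_of_forall_pos_le_add fun ε hε => ?_
  obtain ⟨ξ, h1, h2⟩ := exists_of_distSkorokhod_lt (lt_add_of_pos_right (distSkorokhod v u) hε)
  refine distSkorokhod_le (by linarith [distSkorokhod_nonneg v u]) ξ.symm (fun α => ?_) ?_
  · have := h1 (ξ.symm α)
    rwa [ξ.apply_symm_apply, abs_sub_comm] at this
  · rwa [← distSup_reparam ξ, reparam_symm, distSup_comm]

theorem distSkorokhod_triangle (u v w : FuzzySet X) :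
    distSkorokhod u w ≤ distSkorokhod u v + distSkorokhod v w := by
  refine le_of_forall_pos_le_add fun ε hε => ?_
  obtain ⟨ξ, h1, h2⟩ :=
    exists_of_distSkorokhod_lt (lt_add_of_pos_right (distSkorokhod u v) (half_pos hε))
  obtain ⟨η, h3, h4⟩ :=
    exists_of_distSkorokhod_lt (lt_add_of_pos_right (distSkorokhod v w) (half_pos hε))
  have hn1 := distSkorokhod_nonneg u v
  have hn2 := distSkorokhod_nonneg v w
  refine distSkorokhod_le (by linarith) (η.trans ξ) (fun α => ?_) ?_
  · have := abs_sub_le (ξ (η α) : ℝ) (η α : ℝ) (α : ℝ)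
    have a := h1 (η α)
    have b := h3 α
    change |(ξ (η α) : ℝ) - (α : ℝ)| ≤ _
    linarith
  · have e : reparam (η.trans ξ) w = reparam ξ (reparam η w) := ext_fun rfl
    have := distSup_triangle u (reparam ξ v) (reparam ξ (reparam η w))
    rw [distSup_reparam] at this
    rw [e]
    linarith

theorem le_of_distSkorokhod {u v : FuzzySet X} (h : distSkorokhod u v = 0) (x : X) :
    u.toFun x ≤ v.toFun x := by
  by_contra! hlt
  have h0 : u.toFun x ≠ 0 := (lt_of_le_of_lt unitInterval.nonneg' hlt).ne'
  obtain ⟨β, hβ1, hβ2⟩ := exists_between hlt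
  have hev := v.usc x β hβ1
  obtain ⟨r, hr, hball⟩ := Metric.eventually_nhds_iff.1 hev
  have hgap : (0 : ℝ) < (u.toFun x : ℝ) - β := sub_pos.2 hβ2
  set ε : ℝ := min (r / 2) (((u.toFun x : ℝ) - β) / 2) with hεdef
  have hε : 0 < ε := lt_min (half_pos hr) (half_pos hgap)
  have hεr : ε < r := (min_le_left _ _).trans_lt (half_lt_self hr)
  have hεg : ε < (u.toFun x : ℝ) - β := (min_le_right _ _).trans_lt (half_lt_self hgap)
  obtain ⟨ξ, h1, h2⟩ := exists_of_distSkorokhod_lt (h.trans_lt hε)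
  have hx : x ∈ level u.toFun (u.toFun x) := by rw [level_pos _ h0]; exact le_refl (u.toFun x)
  have h3 := ((le_distSup u (reparam ξ v) (u.toFun x)).trans h2).trans_lt hεr
  obtain ⟨y, hy, hxy⟩ := exists_dist_lt_of_hausdorffDist_lt hx h3
    (level_edist_ne_top u (reparam ξ v) _ _)
  rw [level_pos _ h0] at hy
  have hy' : (u.toFun x : ℝ) ≤ (ξ (v.toFun y) : ℝ) := hy
  have hvy : (v.toFun y : ℝ) < β := hball (by rwa [dist_comm] at hxy)
  have := (abs_le.1 (h1 (v.toFun y))).2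
  linarith

theorem eq_of_distSkorokhod {u v : FuzzySet X} (h : distSkorokhod u v = 0) : u = v :=
  ext_fun (funext fun x => le_antisymm (le_of_distSkorokhod h x)
    (le_of_distSkorokhod (le_antisymm (h ▸ distSkorokhod_comm_le v u)
      (distSkorokhod_nonneg v u)) x))

theorem send_edist_ne_top (u v : FuzzySet X) :
    hausdorffEDist (sendograph u.toFun) (sendograph v.toFun) ≠ ⊤ :=
  hausdorffEDist_ne_top_of_nonempty_of_bounded u.sendograph_nonempty v.sendograph_nonempty
    u.sendograph_isCompact.isBounded v.sendograph_isCompact.isBounded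

theorem end_edist_ne_top (u v : FuzzySet X) :
    hausdorffEDist (endograph u.toFun) (endograph v.toFun) ≠ ⊤ := by
  have key : ∀ (w : FuzzySet X) (p : X × I), ∃ q ∈ endograph w.toFun, edist p q ≤ 1 := by
    intro w p
    refine ⟨(p.1, 0), unitInterval.nonneg', ?_⟩
    rw [Prod.edist_eq, edist_self, edist_dist p.2 0]
    refine max_le zero_le_one (ENNReal.ofReal_le_one.2 ?_)
    rw [Subtype.dist_eq, Real.dist_eq]
    have := p.2.2
    simpa [abs_of_nonneg this.1] using this.2
  exact ne_top_of_le_ne_top ENNReal.one_ne_top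
    (hausdorffEDist_le_of_mem_edist (fun p _ => key v p) (fun p _ => key u p))

variable (X)

/-- The supremum metric `d_∞` on normal fuzzy sets. -/
noncomputable abbrev supMetric : MetricSpace (FuzzySet X) where
  dist := distSup
  dist_self := distSup_self
  dist_comm := distSup_comm
  dist_triangle := distSup_triangle
  eq_of_dist_eq_zero := eq_of_distSup

/-- The Skorokhod metric `d_0` on normal fuzzy sets. -/
noncomputable abbrev skorokhodMetric : MetricSpace (FuzzySet X) where
  dist := distSkorokhod
  dist_self := distSkorokhod_self
  dist_comm u v := le_antisymm (distSkorokhod_comm_le u v) (distSkorokhod_comm_le v u)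
  dist_triangle := distSkorokhod_triangle
  eq_of_dist_eq_zero := eq_of_distSkorokhod

/-- The sendograph metric `d_S` on normal fuzzy sets. -/
noncomputable abbrev sendographMetric : MetricSpace (FuzzySet X) where
  dist := distSend
  dist_self _ := hausdorffDist_self_zero
  dist_comm _ _ := hausdorffDist_comm
  dist_triangle u v _ := hausdorffDist_triangle (send_edist_ne_top u v)
  eq_of_dist_eq_zero {u v} h := eq_of_sendograph
    ((u.sendograph_isClosed.hausdorffDist_zero_iff_eq v.sendograph_isClosed
      (send_edist_ne_top u v)).1 h)

/-- The endograph metric `d_E` on normal fuzzy sets. -/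
noncomputable abbrev endographMetric : MetricSpace (FuzzySet X) where
  dist := distEnd
  dist_self _ := hausdorffDist_self_zero
  dist_comm _ _ := hausdorffDist_comm
  dist_triangle u v _ := hausdorffDist_triangle (end_edist_ne_top u v)
  eq_of_dist_eq_zero {u v} h := eq_of_endograph
    ((u.endograph_isClosed.hausdorffDist_zero_iff_eq v.endograph_isClosed
      (end_edist_ne_top u v)).1 h)

end Metrics

end FuzzySet

/-- The Hausdorff metric `d_H` on non-empty compact sets. -/
noncomputable abbrev hausdorffMetric (X : Type*) [MetricSpace X] :
    MetricSpace (TopologicalSpace.NonemptyCompacts X) :=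
  NonemptyCompacts.instMetricSpace

/-- `T` has a dense orbit. -/
def Hypercyclic {𝕜 X : Type*} [Semiring 𝕜] [AddCommMonoid X] [TopologicalSpace X] [Module 𝕜 X]
    (T : X →L[𝕜] X) : Prop :=
  ∃ x : X, Dense (range fun n : ℕ => T^[n] x)

end FuzzyChaos

/-! A hypercyclic vector `x` returns arbitrarily close to 0, so `T^[ns k] x → 0` along some `ns`.
Since `T` commutes with its iterates and fixes 0, the same holds on the whole orbit of `x`, hence on
a dense set `D`. This gives proximality. Separation comes from a nonzero functional `φ`: adding a
small multiple of `x` to a vector makes `φ ∘ T^[n]` arbitrarily large at late times. Both are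
generic properties of pairs, and the Kuratowski–Mycielski theorem (`exists_cantor_map_of_dense`)
yields a Cantor family `f s` of vectors with both for all distinct indices
(`Hypercyclic.exists_cantor_map`).

To reach every open set `U j` of compact or fuzzy sets, choose in it a point `A j` with finite
support in `D`, and translate it by small vectors `f s - p`. Along `ns` the finite supports are
pulled to 0, so proximality survives. For separation, the supremum of `φ` over the support is
1-Lipschitz up to a modulus for the Hausdorff distance, and a translation merely shifts it. The
contribution of `A j` at time `n` is a fixed number, and the countably many differences of such
sequences are built into the generic conditions in advance. The constant `c` depends only on `φ`, so
one scrambling constant serves all choices of `U j`. This is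
`cantorDenselyLiYorkeChaotic_of_translation`; it covers `d_H`, `d_∞` and `d_0`, whose distances all
dominate the Hausdorff distance of the supports.

For `d_S` and `d_E` the embedding of points as characteristic functions is enough: it conjugates `T`
into the Zadeh extension, and distances are preserved up to truncation at 1
(`uniformlyLiYorkeChaotic_of_semiconj`). -/

namespace FuzzyChaos

/-! ### Mycielski's theorem by Baire category in `C(ℕ → Bool, X)`. -/

section Mycielski

theorem isOpen_setOf_forall_pair_mem {α X : Type*} [TopologicalSpace α] [CompactSpace α]
    [T2Space α] [TopologicalSpace X] {K : Set (α × α)} (hK : IsCompact K) {R : Set (X × X)}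
    (hR : IsOpen R) : IsOpen {f : C(α, X) | ∀ p ∈ K, (f p.1, f p.2) ∈ R} := by
  rw [isOpen_iff_eventually]
  intro f hf
  refine hK.eventually_forall_of_forall_eventually fun p hp => ?_
  have hc : Continuous fun q : C(α, X) × (α × α) => (q.1 q.2.1, q.1 q.2.2) := by fun_prop
  exact (hR.preimage hc).mem_nhds (hf p hp)

/-- A continuous function on the Cantor space is nearly constant on the cylinders of some length. -/
theorem exists_cylinder_dist_lt {X : Type*} [PseudoMetricSpace X] (f : C(ℕ → Bool, X)) {ε : ℝ}
    (hε : 0 < ε) : ∃ m : ℕ, ∀ s t : ℕ → Bool, (∀ i < m, s i = t i) → dist (f s) (f t) < ε := by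
  by_contra! h
  choose s t hst hd using h
  obtain ⟨a, φ, hφ, ha⟩ := SeqCompactSpace.tendsto_subseq s
  have hb : Tendsto (t ∘ φ) atTop (𝓝 a) := by
    rw [tendsto_pi_nhds] at ha ⊢
    intro i
    refine (ha i).congr' ?_
    filter_upwards [eventually_gt_atTop i] with k hk
    exact hst (φ k) i (hk.trans_le (hφ.id_le k))
  have h0 : Tendsto (fun k => dist (f (s (φ k))) (f (t (φ k)))) atTop (𝓝 0) := by
    simpa using ((f.continuous.tendsto a).comp ha).dist ((f.continuous.tendsto a).comp hb)
  obtain ⟨k, hk⟩ := (h0.eventually_lt_const hε).exists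
  exact (hd (φ k)).not_gt hk

/-- A finite family can be perturbed so that all pairs of distinct members lie in a given open
dense relation. -/
theorem dense_setOf_pairwise_mem {ι X : Type*} [Finite ι] [TopologicalSpace X] {R : Set (X × X)}
    (hR : IsOpen R) (hd : Dense R) :
    Dense {g : ι → X | ∀ c d, c ≠ d → (g c, g d) ∈ R} := by
  classical
  have h1 : ∀ p : ι × ι, IsOpen {g : ι → X | p.1 ≠ p.2 → (g p.1, g p.2) ∈ R} := by
    intro p
    by_cases hp : p.1 = p.2
    · simp [hp]
    · simp only [ne_eq, hp, not_false_eq_true, forall_const]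
      exact hR.preimage (f := fun g : ι → X => (g p.1, g p.2)) (by fun_prop)
  have h2 : ∀ p : ι × ι, Dense {g : ι → X | p.1 ≠ p.2 → (g p.1, g p.2) ∈ R} := by
    intro p
    by_cases hp : p.1 = p.2
    · simp [hp]
    · intro g
      -- Overwriting two coordinates is continuous in the new pair, so density of `R` in `X × X`
      -- carries over to the two-coordinate condition at `g`.
      let Φ : X × X → ι → X := fun q => Function.update (Function.update g p.1 q.1) p.2 q.2
      have hΦ : Continuous Φ := by fun_prop
      have hg : Φ (g p.1, g p.2) = g := by simp [Φ]
      have hm := hΦ.range_subset_closure_image_dense hd ⟨(g p.1, g p.2), hg⟩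
      refine closure_mono ?_ hm
      rintro _ ⟨q, hq, rfl⟩ _
      simpa [Φ, Function.update_of_ne hp] using hq
  have key : ∀ s : Set (ι × ι), s.Finite →
      IsOpen (⋂ p ∈ s, {g : ι → X | p.1 ≠ p.2 → (g p.1, g p.2) ∈ R}) ∧
      Dense (⋂ p ∈ s, {g : ι → X | p.1 ≠ p.2 → (g p.1, g p.2) ∈ R}) := by
    intro s hs
    induction s, hs using Set.Finite.induction_on with
    | empty => simp
    | insert _ _ ih =>
      rw [biInter_insert]
      exact ⟨(h1 _).inter ih.1, (h2 _).inter_of_isOpen_left ih.2 (h1 _)⟩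
  refine (key univ finite_univ).2.mono fun g hg c d hcd => ?_
  exact mem_iInter₂.1 hg (c, d) (mem_univ _) hcd

/-- A continuous `f` is close to a map that is constant on cylinders of length `m`. Its finitely
many values can be perturbed into pairwise general position, and sequences differing at `i` lie in
different cylinders once `i < m`. -/
theorem dense_setOf_separated_pair_mem {X : Type*} [MetricSpace X] {R : Set (X × X)}
    (hR : IsOpen R) (hd : Dense R) (i : ℕ) :
    Dense {f : C(ℕ → Bool, X) | ∀ s t : ℕ → Bool, s i ≠ t i → (f s, f t) ∈ R} := by
  rw [Metric.dense_iff]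
  intro f ε hε
  obtain ⟨m₀, hm₀⟩ := exists_cylinder_dist_lt f (show 0 < ε / 4 by positivity)
  set m := max m₀ (i + 1)
  let res : (ℕ → Bool) → Fin m → Bool := fun s k => s k
  let ext : (Fin m → Bool) → ℕ → Bool := fun c k => if h : k < m then c ⟨k, h⟩ else false
  have hext : ∀ s, dist (f (ext (res s))) (f s) < ε / 4 := fun s =>
    hm₀ _ _ fun k hk => dif_pos (hk.trans_le (le_max_left m₀ (i + 1)))
  obtain ⟨g, hg, hgR⟩ := Metric.dense_iff.1 (dense_setOf_pairwise_mem (ι := Fin m → Bool) hR hd)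
    (fun c => f (ext c)) (ε / 4) (by positivity)
  have hg' : ∀ c, dist (g c) (f (ext c)) < ε / 4 := fun c => (dist_le_pi_dist _ _ c).trans_lt hg
  let f' : C(ℕ → Bool, X) := ⟨fun s => g (res s),
    continuous_of_discreteTopology.comp (by fun_prop)⟩
  refine ⟨f', ?_, fun s t hst => ?_⟩
  · rw [mem_ball]
    refine lt_of_le_of_lt ((ContinuousMap.dist_le (show 0 ≤ ε / 2 by positivity)).2 fun s => ?_)
      (half_lt_self hε)
    have h1 := hg' (res s)
    have h2 := hext s
    have h3 := dist_triangle (g (res s)) (f (ext (res s))) (f s)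
    change dist (g (res s)) (f s) ≤ ε / 2
    linarith
  · refine hgR (res s) (res t) fun h => hst ?_
    exact congrFun h ⟨i, lt_of_lt_of_le (Nat.lt_succ_self i) (le_max_right m₀ (i + 1))⟩

/-- **Kuratowski–Mycielski theorem**: countably many open dense relations on a complete metric space
are all satisfied by the pairs of distinct points of some image of the Cantor space. -/
theorem exists_cantor_map_of_dense {ι X : Type*} [Countable ι] [MetricSpace X] [CompleteSpace X]
    [Nonempty X] (R : ι → Set (X × X)) (hR : ∀ n, IsOpen (R n)) (hd : ∀ n, Dense (R n)) :
    ∃ f : C(ℕ → Bool, X), ∀ s t, s ≠ t → ∀ n, (f s, f t) ∈ R n := by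
  have ho : ∀ q : ℕ × ι,
      IsOpen {f : C(ℕ → Bool, X) | ∀ s t : ℕ → Bool, s q.1 ≠ t q.1 → (f s, f t) ∈ R q.2} := by
    intro q
    -- Since `Bool` is discrete, the pairs differing at a fixed coordinate form a compact set; the
    -- full off-diagonal set is only the countable union of these.
    have hK : IsClosed {p : (ℕ → Bool) × (ℕ → Bool) | p.1 q.1 ≠ p.2 q.1} := by
      have : IsClosed {b : Bool × Bool | b.1 ≠ b.2} := isClosed_discrete _
      exact this.preimage (f := fun p : (ℕ → Bool) × (ℕ → Bool) => (p.1 q.1, p.2 q.1))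
        (by fun_prop)
    convert isOpen_setOf_forall_pair_mem hK.isCompact (hR q.2) using 1
    ext f
    exact ⟨fun h p hp => h p.1 p.2 hp, fun h s t hst => h (s, t) hst⟩
  have : Nonempty C(ℕ → Bool, X) := ⟨.const _ (Classical.arbitrary X)⟩
  obtain ⟨f, hf⟩ := (dense_iInter_of_isOpen ho fun q =>
    dense_setOf_separated_pair_mem (hR q.2) (hd q.2) q.1).nonempty
  refine ⟨f, fun s t hst n => ?_⟩
  obtain ⟨i, hi⟩ := Function.ne_iff.1 hst
  exact mem_iInter.1 hf (i, n) s t hi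

end Mycielski

/-! ### Generic pairs of vectors under a hypercyclic operator. -/

section Linear

variable {X : Type*} [AddCommGroup X] [Module ℝ X] [MetricSpace X]

/-- A nontrivial real topological vector space has no isolated points, so deleting finitely many
points keeps a set dense. -/
theorem Hypercyclic.dense_tail [IsTopologicalAddGroup X] [ContinuousSMul ℝ X] [Nontrivial X]
    {T : X →L[ℝ] X} {x : X}
    (hx : Dense (range fun n : ℕ => T^[n] x)) (N : ℕ) :
    Dense ((fun n : ℕ => T^[n] x) '' Ici N) := by
  have : ∀ y : X, NeBot (𝓝[≠] y) := Module.punctured_nhds_neBot ℝ X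
  refine (hx.sdiff_finite ((finite_Iio N).image fun n : ℕ => T^[n] x)).mono ?_
  rintro _ ⟨⟨n, rfl⟩, hn⟩
  exact ⟨n, mem_Ici.2 (not_lt.1 fun h => hn ⟨n, h, rfl⟩), rfl⟩

/-- A hypercyclic vector tends to zero along a subsequence, and then so does a dense set of
vectors. -/
theorem Hypercyclic.exists_dense_tendsto_zero [IsTopologicalAddGroup X] [ContinuousSMul ℝ X] [Nontrivial X]
    {T : X →L[ℝ] X} (hT : Hypercyclic T) :
    ∃ ns : ℕ → ℕ, Tendsto ns atTop atTop ∧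
      Dense {z : X | Tendsto (fun k => T^[ns k] z) atTop (𝓝 0)} := by
  obtain ⟨x, hx⟩ := hT
  have h : ∀ k : ℕ, ∃ n ≥ k, dist (T^[n] x) 0 < 1 / ((k : ℝ) + 1) := by
    intro k
    obtain ⟨_, hd, n, hn, rfl⟩ := Metric.dense_iff.1 (dense_tail hx k) 0 (1 / ((k : ℝ) + 1))
      (by positivity)
    exact ⟨n, hn, hd⟩
  choose ns hns hd using h
  have hx0 : Tendsto (fun k => T^[ns k] x) atTop (𝓝 0) := by
    rw [tendsto_iff_dist_tendsto_zero]
    exact squeeze_zero (fun _ => dist_nonneg) (fun k => (hd k).le)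
      tendsto_one_div_add_atTop_nhds_zero_nat
  refine ⟨ns, tendsto_atTop_mono hns tendsto_id, hx.mono ?_⟩
  rintro _ ⟨m, rfl⟩
  have := ((T.continuous.iterate m).tendsto 0).comp hx0
  rw [Function.iterate_fixed (map_zero T) m] at this
  refine this.congr fun k => ?_
  simp only [Function.comp_apply, ← Function.iterate_add_apply, add_comm]

theorem dense_setOf_pair_near_zero {T : X →L[ℝ] X} {ns : ℕ → ℕ}
    (hd : Dense {z : X | Tendsto (fun k => T^[ns k] z) atTop (𝓝 0)}) (N : ℕ) {η : ℝ} (hη : 0 < η) :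
    Dense {p : X × X | ∃ k ≥ N, dist (T^[ns k] p.1) 0 < η ∧ dist (T^[ns k] p.2) 0 < η} := by
  refine (hd.prod hd).mono ?_
  rintro ⟨z, w⟩ ⟨hz, hw⟩
  have h1 := (tendsto_iff_dist_tendsto_zero.1 hz).eventually_lt_const hη
  have h2 := (tendsto_iff_dist_tendsto_zero.1 hw).eventually_lt_const hη
  obtain ⟨k, ⟨h1, h2⟩, hk⟩ := ((h1.and h2).and (eventually_ge_atTop N)).exists
  exact ⟨k, hk, h1, h2⟩

theorem isOpen_setOf_pair_near_zero (T : X →L[ℝ] X) (ns : ℕ → ℕ) (N : ℕ) (η : ℝ) :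
    IsOpen {p : X × X | ∃ k ≥ N, dist (T^[ns k] p.1) 0 < η ∧ dist (T^[ns k] p.2) 0 < η} := by
  have hT : ∀ n, Continuous T^[n] := fun n => T.continuous.iterate n
  have : {p : X × X | ∃ k ≥ N, dist (T^[ns k] p.1) 0 < η ∧ dist (T^[ns k] p.2) 0 < η} =
      ⋃ k ≥ N, {p : X × X | dist (T^[ns k] p.1) 0 < η} ∩ {p | dist (T^[ns k] p.2) 0 < η} := by
    ext p; simp [and_left_comm]
  rw [this]
  refine isOpen_biUnion fun k _ => (isOpen_lt ?_ continuous_const).inter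
    (isOpen_lt ?_ continuous_const)
  · exact ((hT _).comp continuous_fst).dist continuous_const
  · exact ((hT _).comp continuous_snd).dist continuous_const

theorem isOpen_setOf_pair_separated (T : X →L[ℝ] X) (φ : StrongDual ℝ X) (g : ℕ → ℝ) (N : ℕ) :
    IsOpen {p : X × X | ∃ n ≥ N, 1 < |φ (T^[n] p.1) - φ (T^[n] p.2) + g n|} := by
  have hT : ∀ n, Continuous T^[n] := fun n => T.continuous.iterate n
  have : {p : X × X | ∃ n ≥ N, 1 < |φ (T^[n] p.1) - φ (T^[n] p.2) + g n|} =
      ⋃ n ≥ N, {p : X × X | 1 < |φ (T^[n] p.1) - φ (T^[n] p.2) + g n|} := by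
    ext p; simp
  rw [this]
  refine isOpen_biUnion fun n _ => isOpen_lt continuous_const ?_
  exact (((φ.continuous.comp ((hT n).comp continuous_fst)).sub
    (φ.continuous.comp ((hT n).comp continuous_snd))).add continuous_const).abs

theorem iterate_map_add_smul (T : X →L[ℝ] X) (n : ℕ) (z x : X) (δ : ℝ) :
    T^[n] (z + δ • x) = T^[n] z + δ • T^[n] x := by
  have h : Function.Commute T (δ • ·) := fun y => map_smul T δ y
  rw [iterate_map_add]
  exact congrArg _ (h.iterate_left n x)

/-- Moving `z` to `z + δ • x` adds `δ * φ (T^[n] x)`, which exceeds 2 at some `n ≥ N` because the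
tail of the orbit of `x` meets every nonempty open set. The correction `g` is arbitrary since it is
the same before and after the move. -/
theorem Hypercyclic.dense_setOf_pair_separated [IsTopologicalAddGroup X] [ContinuousSMul ℝ X] [Nontrivial X]
    {T : X →L[ℝ] X} (hT : Hypercyclic T)
    {φ : StrongDual ℝ X} (hφ : φ ≠ 0) (g : ℕ → ℝ) (N : ℕ) :
    Dense {p : X × X | ∃ n ≥ N, 1 < |φ (T^[n] p.1) - φ (T^[n] p.2) + g n|} := by
  obtain ⟨x, hx⟩ := hT
  rintro ⟨z, w⟩
  rw [mem_closure_iff_nhds]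
  intro V hV
  have hc : Tendsto (fun δ : ℝ => (z + δ • x, w)) (𝓝[≠] 0) (𝓝 (z, w)) := by
    have : Continuous fun δ : ℝ => (z + δ • x, w) := by fun_prop
    simpa using (this.tendsto 0).mono_left nhdsWithin_le_nhds
  obtain ⟨δ, hδV, hδ⟩ := ((hc.eventually_mem hV).and self_mem_nhdsWithin).exists
  replace hδ : δ ≠ 0 := hδ
  obtain ⟨v, hv⟩ : ∃ v, φ v ≠ 0 := by
    by_contra! h
    exact hφ (ContinuousLinearMap.ext h)
  have ho : IsOpen {y : X | 2 < δ * φ y} :=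
    isOpen_lt continuous_const (continuous_const.mul φ.continuous)
  have hne : {y : X | 2 < δ * φ y}.Nonempty := by
    refine ⟨(3 / (δ * φ v)) • v, ?_⟩
    change 2 < δ * φ ((3 / (δ * φ v)) • v)
    rw [map_smul, smul_eq_mul]
    have : δ * (3 / (δ * φ v) * φ v) = 3 := by field_simp
    rw [this]; norm_num
  obtain ⟨_, h2, n, hn, rfl⟩ := (dense_tail hx N).inter_open_nonempty _ ho hne
  replace h2 : 2 < δ * φ (T^[n] x) := h2
  -- Either the original pair is already separated at time `n`, or its value is at least `-1` and
  -- the added term, larger than 2, brings it above 1.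
  by_cases h : 1 < |φ (T^[n] z) - φ (T^[n] w) + g n|
  · exact ⟨(z, w), mem_of_mem_nhds hV, n, hn, h⟩
  · refine ⟨(z + δ • x, w), hδV, n, hn, ?_⟩
    rw [iterate_map_add_smul, map_add, map_smul, smul_eq_mul]
    have := abs_le.1 (not_lt.1 h)
    exact lt_of_lt_of_le (by linarith [this.1]) (le_abs_self _)

/-- The sequences `h i` will record the values of `φ` contributed by the `i`-th finite support, so
that translates of different base points are separated as well. -/
theorem Hypercyclic.exists_cantor_map [CompleteSpace X] [IsTopologicalAddGroup X]
    [ContinuousSMul ℝ X] [Nontrivial X] {T : X →L[ℝ] X} (hT : Hypercyclic T)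
    {ns : ℕ → ℕ} (hd : Dense {z : X | Tendsto (fun k => T^[ns k] z) atTop (𝓝 0)})
    {φ : StrongDual ℝ X} (hφ : φ ≠ 0) (h : ℕ → ℕ → ℝ) :
    ∃ f : C(ℕ → Bool, X), ∀ s t, s ≠ t →
      (∀ N : ℕ, ∀ η > 0, ∃ k ≥ N, dist (T^[ns k] (f s)) 0 < η ∧ dist (T^[ns k] (f t)) 0 < η) ∧
      ∀ i j N : ℕ, ∃ n ≥ N, 1 < |φ (T^[n] (f s)) - φ (T^[n] (f t)) + (h i n - h j n)| := by
  let R : (ℕ × ℕ) ⊕ (ℕ × ℕ × ℕ) → Set (X × X) := Sum.elim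
    (fun q => {p | ∃ k ≥ q.1, dist (T^[ns k] p.1) 0 < 1 / ((q.2 : ℝ) + 1) ∧
      dist (T^[ns k] p.2) 0 < 1 / ((q.2 : ℝ) + 1)})
    (fun q => {p | ∃ n ≥ q.2.2, 1 < |φ (T^[n] p.1) - φ (T^[n] p.2) + (h q.1 n - h q.2.1 n)|})
  obtain ⟨f, hf⟩ := exists_cantor_map_of_dense R
    (by rintro (q | q)
        · exact isOpen_setOf_pair_near_zero T ns _ _
        · exact isOpen_setOf_pair_separated T φ (fun n => h q.1 n - h q.2.1 n) _)
    (by rintro (q | q)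
        · exact dense_setOf_pair_near_zero hd _ (by positivity)
        · exact hT.dense_setOf_pair_separated hφ (fun n => h q.1 n - h q.2.1 n) _)
  refine ⟨f, fun s t hst => ⟨fun N η hη => ?_, fun i j N => hf s t hst (.inr (i, j, N))⟩⟩
  obtain ⟨m, hm⟩ := exists_nat_one_div_lt hη
  obtain ⟨k, hk, h1, h2⟩ := hf s t hst (.inl (N, m))
  exact ⟨k, hk, h1.trans hm, h2.trans hm⟩

end Linear

/-! ### Criteria for Li-Yorke pairs and Cantor sets. -/

section Pairs

variable {Y : Type*} (m : MetricSpace Y) {F : Y → Y} {ε : ℝ} {x y : Y}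

theorem isLiYorkePair_of_frequently (h1 : ∀ N, ∃ n ≥ N, ε ≤ dist (F^[n] x) (F^[n] y))
    (h2 : ∀ η > 0, ∀ N, ∃ n ≥ N, dist (F^[n] x) (F^[n] y) ≤ η) : IsLiYorkePair m F ε x y := by
  refine ⟨le_limsup_of_frequently_le (frequently_atTop.2 fun N => ?_), le_antisymm ?_ ?_⟩
  · obtain ⟨n, hn, h⟩ := h1 N
    exact ⟨n, hn, EReal.coe_le_coe_iff.2 h⟩
  · refine le_of_forall_gt_imp_ge_of_dense fun b hb => ?_
    obtain ⟨η, h0, hη⟩ := EReal.lt_iff_exists_real_btwn.1 hb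
    refine le_trans (liminf_le_of_frequently_le (frequently_atTop.2 fun N => ?_)) hη.le
    obtain ⟨n, hn, h⟩ := h2 η (EReal.coe_pos.1 h0) N
    exact ⟨n, hn, EReal.coe_le_coe_iff.2 h⟩
  · exact le_liminf_of_le (by isBoundedDefault)
      (Eventually.of_forall fun n => EReal.coe_nonneg.2 dist_nonneg)

/-- Makes the Cantor parametrizations injective: separation of orbits already forces distinct
starting points. -/
theorem ne_of_le_dist_iterate (hε : 0 < ε) (h : ∀ N, ∃ n ≥ N, ε ≤ dist (F^[n] x) (F^[n] y)) :
    x ≠ y := by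
  rintro rfl
  obtain ⟨n, -, h⟩ := h 0
  rw [dist_self] at h
  exact hε.not_ge h

theorem isCantorSet_range {Y : Type*} [TopologicalSpace Y] [T2Space Y] {e : (ℕ → Bool) → Y}
    (he : Continuous e) (hi : Function.Injective e) : IsCantorSet (range e) :=
  ⟨((he.isClosedEmbedding hi).isEmbedding.toHomeomorph.symm).trans
    cantorSetHomeomorphNatToBool.symm⟩

end Pairs

/-! ### Disjoint Cantor blocks accumulating at the zero sequence. -/

section CantorBlocks

/-- The sequence `0 ⋯ 0 1 s` with `k` leading zeros. -/
def blockCode (k : ℕ) (s : ℕ → Bool) : ℕ → Bool :=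
  fun n => if n < k then false else if n = k then true else s (n - k - 1)

theorem continuous_blockCode (k : ℕ) : Continuous (blockCode k) := by
  refine continuous_pi fun n => ?_
  unfold blockCode
  split_ifs <;> fun_prop

theorem blockCode_of_lt {k n : ℕ} (s : ℕ → Bool) (h : n < k) : blockCode k s n = false := if_pos h

theorem blockCode_self (k : ℕ) (s : ℕ → Bool) : blockCode k s k = true := by simp [blockCode]

theorem blockCode_injective {k l : ℕ} {s t : ℕ → Bool} (h : blockCode k s = blockCode l t) :
    k = l ∧ s = t := by
  have hkl : k = l := by
    rcases lt_trichotomy k l with hlt | heq | hgt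
    · have := congrFun h k
      rw [blockCode_self, blockCode_of_lt t hlt] at this
      cases this
    · exact heq
    · have := congrFun h l
      rw [blockCode_self, blockCode_of_lt s hgt] at this
      cases this
  refine ⟨hkl, funext fun n => ?_⟩
  subst hkl
  have := congrFun h (n + k + 1)
  have h1 : ¬ n + k + 1 < k := by omega
  have h2 : ¬ n + k + 1 = k := by omega
  have h3 : n + k + 1 - k - 1 = n := by omega
  simpa only [blockCode, h1, h2, h3, if_false] using this

end CantorBlocks

/-! ### Linear functionals and the Hausdorff distance. -/

section Functional

variable {X : Type*} [AddCommGroup X] [Module ℝ X] [MetricSpace X]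

theorem sSup_image_le_of_hausdorffDist_lt (φ : StrongDual ℝ X) {c : ℝ}
    (hφ : ∀ u v, dist u v < c → |φ u - φ v| < 1) {B C : Set X} (hB : IsCompact B)
    (hC : IsCompact C) (hBn : B.Nonempty) (hCn : C.Nonempty) (h : hausdorffDist B C < c) :
    sSup (φ '' B) ≤ sSup (φ '' C) + 1 := by
  obtain ⟨b, hb, hbe⟩ := (hB.image φ.continuous).sSup_mem (hBn.image φ)
  obtain ⟨v, hv, hbv⟩ := exists_dist_lt_of_hausdorffDist_lt hb h
    (hausdorffEDist_ne_top_of_nonempty_of_bounded hBn hCn hB.isBounded hC.isBounded)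
  have h1 := (abs_lt.1 (hφ b v hbv)).2
  have h2 : φ v ≤ sSup (φ '' C) :=
    le_csSup (hC.image φ.continuous).bddAbove (mem_image_of_mem φ hv)
  linarith

theorem le_hausdorffDist_of_sSup_image (φ : StrongDual ℝ X) {c : ℝ}
    (hφ : ∀ u v, dist u v < c → |φ u - φ v| < 1) {B C : Set X} (hB : IsCompact B)
    (hC : IsCompact C) (hBn : B.Nonempty) (hCn : C.Nonempty)
    (h : 1 < |sSup (φ '' B) - sSup (φ '' C)|) : c ≤ hausdorffDist B C := by
  by_contra! hlt
  have h1 := sSup_image_le_of_hausdorffDist_lt φ hφ hB hC hBn hCn hlt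
  have h2 := sSup_image_le_of_hausdorffDist_lt φ hφ hC hB hCn hBn (by rwa [hausdorffDist_comm])
  exact h.not_ge (abs_le.2 ⟨by linarith, by linarith⟩)

/-- Translation acts on the supremum of `φ` as an additive shift, which is what reduces separation
of translated sets to a condition on vectors with a correction. -/
theorem sSup_image_translate (φ : StrongDual ℝ X) {B : Set X} (hB : IsCompact B)
    (hBn : B.Nonempty) (w : X) :
    sSup (φ '' ((w + ·) '' B)) = φ w + sSup (φ '' B) := by
  have hg := (hB.image φ.continuous).isGreatest_sSup (hBn.image φ)
  refine IsGreatest.csSup_eq ⟨?_, ?_⟩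
  · obtain ⟨b, hb, hbe⟩ := hg.1
    exact ⟨w + b, ⟨b, hb, rfl⟩, by rw [map_add, hbe]⟩
  · rintro _ ⟨_, ⟨b, hb, rfl⟩, rfl⟩
    change φ (w + b) ≤ _
    rw [map_add]
    have := hg.2 (mem_image_of_mem φ hb)
    linarith

theorem dist_add_zero_le {X : Type*} [AddCommGroup X] [MetricSpace X]
    (htrans : ∀ x y z : X, dist (x + z) (y + z) = dist x y) (a b : X) :
    dist (a + b) 0 ≤ dist a 0 + dist b 0 := by
  have h := dist_triangle (a + b) b 0
  have h' := htrans a 0 b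
  rw [zero_add] at h'
  linarith

/-- By linearity and invariance of the metric, continuity at 0 is uniform. The resulting `c`
provides the scrambling constant. -/
theorem exists_modulus (htrans : ∀ x y z : X, dist (x + z) (y + z) = dist x y)
    (φ : StrongDual ℝ X) : ∃ c > 0, ∀ u v, dist u v < c → |φ u - φ v| < 1 := by
  obtain ⟨c, hc, h⟩ := Metric.continuous_iff.1 φ.continuous 0 1 one_pos
  refine ⟨c, hc, fun u v huv => ?_⟩
  have := h (u - v) (by rw [← htrans _ _ v]; simpa using huv)
  simpa [Real.dist_eq] using this

theorem uniformContinuous_of_translationInvariant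
    (htrans : ∀ x y z : X, dist (x + z) (y + z) = dist x y) (T : X →L[ℝ] X) {ε : ℝ} (hε : 0 < ε) :
    ∃ δ > 0, ∀ u v, dist u v < δ → dist (T u) (T v) < ε := by
  obtain ⟨c, hc, h⟩ := Metric.continuous_iff.1 T.continuous 0 ε hε
  refine ⟨c, hc, fun u v huv => ?_⟩
  have := h (u - v) (by rw [← htrans _ _ v]; simpa using huv)
  rw [← htrans _ _ (T v)] at this
  simpa using this

end Functional

/-! ### The two abstract chaos criteria. -/

section Translation

variable {X : Type*} [AddCommGroup X] [Module ℝ X] [MetricSpace X] [CompleteSpace X]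
  [IsTopologicalAddGroup X] [ContinuousSMul ℝ X] [LocallyConvexSpace ℝ X] [Nontrivial X]

/-- A system over a hypercyclic operator `T`, whose points `y` have compact supports `S y ⊆ X` on
which it acts by `T`, is Cantor-densely Li-Yorke chaotic if points can be translated by vectors and
the distance is controlled by the supports. -/
theorem cantorDenselyLiYorkeChaotic_of_translation
    (htrans : ∀ x y z : X, dist (x + z) (y + z) = dist x y)
    {T : X →L[ℝ] X} (hT : Hypercyclic T) {Y : Type*} (m : MetricSpace Y) {F : Y → Y}
    (hF : Continuous F) (S : Y → Set X) (tr : X → Y → Y)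
    (hSc : ∀ y, IsCompact (S y)) (hSn : ∀ y, (S y).Nonempty) (hSF : ∀ y, S (F y) = T '' S y)
    (htr : ∀ y, Continuous fun z => tr z y) (htr0 : ∀ y, tr 0 y = y)
    (hStr : ∀ z y, S (tr z y) = (z + ·) '' S y)
    (hlow : ∀ y y', hausdorffDist (S y) (S y') ≤ dist y y')
    (hupp : ∀ y y' η, 0 ≤ η → (∀ a ∈ S y, ∀ b ∈ S y', dist a b ≤ η) → dist y y' ≤ η)
    (hdense : ∀ D : Set X, Dense D → ∀ U : Set Y, IsOpen U → U.Nonempty →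
      ∃ y ∈ U, (S y).Finite ∧ S y ⊆ D) :
    CantorDenselyLiYorkeChaotic m F := by
  obtain ⟨ns, hns, hD⟩ := hT.exists_dense_tendsto_zero
  obtain ⟨v, hv⟩ := exists_ne (0 : X)
  obtain ⟨φ, hφv⟩ := SeparatingDual.exists_ne_zero (R := ℝ) hv
  have hφ : φ ≠ 0 := by rintro rfl; simp at hφv
  obtain ⟨c, hc, hφc⟩ := exists_modulus htrans φ
  have hSFn : ∀ n y, S (F^[n] y) = T^[n] '' S y := by
    intro n
    induction n with
    | zero => simp
    | succ n ih =>
      intro y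
      rw [Function.iterate_succ_apply, ih, hSF, Function.iterate_succ, image_comp]
  refine ⟨hF, c, hc, fun U hU => ?_⟩
  choose A hAU hAf hAD using fun j => hdense _ hD (U j) (hU j).1 (hU j).2
  -- The corrections are the suprema of `φ` over the iterated supports of the base points.
  obtain ⟨f, hf⟩ := hT.exists_cantor_map hD hφ fun j n => sSup (φ '' (T^[n] '' S (A j)))
  -- Subtracting `p` makes the translation vectors small for sequences with many leading zeros; `p`
  -- cancels in all differences.
  set p := f fun _ => false
  have hS : ∀ j s n, S (F^[n] (tr (f s - p) (A j))) =
      (T^[n] (f s - p) + ·) '' (T^[n] '' S (A j)) := by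
    intro j s n
    rw [hSFn, hStr, image_image, image_image]
    simp only [iterate_map_add]
  have hSn' : ∀ j n, (T^[n] '' S (A j)).Nonempty := fun j n => (hSn _).image _
  have hSc' : ∀ j n, IsCompact (T^[n] '' S (A j)) := fun j n =>
    (hSc _).image (T.continuous.iterate n)
  have hfar : ∀ i j s t, s ≠ t → ∀ N, ∃ n ≥ N,
      c ≤ dist (F^[n] (tr (f s - p) (A i))) (F^[n] (tr (f t - p) (A j))) := by
    intro i j s t hst N
    obtain ⟨n, hn, h⟩ := (hf s t hst).2 i j N
    refine ⟨n, hn, le_trans ?_ (hlow _ _)⟩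
    refine le_hausdorffDist_of_sSup_image φ hφc (hSc _) (hSc _) (hSn _) (hSn _) ?_
    rw [hS, hS, sSup_image_translate φ (hSc' i n) (hSn' i n),
      sSup_image_translate φ (hSc' j n) (hSn' j n), iterate_map_sub, iterate_map_sub, map_sub,
      map_sub]
    convert h using 2
    ring
  have hnear : ∀ i j s t, s ≠ t → ∀ η > 0, ∀ N, ∃ n ≥ N,
      dist (F^[n] (tr (f s - p) (A i))) (F^[n] (tr (f t - p) (A j))) ≤ η := by
    intro i j s t hst η hη N
    -- Finiteness of the support makes the pointwise convergence to 0 uniform on it.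
    have hA : ∀ j, ∀ᶠ k in atTop, ∀ a ∈ S (A j), dist (T^[ns k] a) 0 < η / 4 := fun j =>
      (eventually_all_finite (hAf j)).2 fun a ha =>
        (tendsto_iff_dist_tendsto_zero.1 (hAD j ha)).eventually_lt_const (by positivity)
    obtain ⟨K, hK⟩ := eventually_atTop.1
      (((hA i).and (hA j)).and (hns.eventually (eventually_ge_atTop N)))
    obtain ⟨k, hk, h1, h2⟩ := (hf s t hst).1 K (η / 4) (by positivity)
    obtain ⟨⟨h3, h4⟩, h5⟩ := hK k hk
    refine ⟨ns k, h5, hupp _ _ _ hη.le ?_⟩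
    rw [hS, hS]
    rintro _ ⟨_, ⟨a, ha, rfl⟩, rfl⟩ _ ⟨_, ⟨b, hb, rfl⟩, rfl⟩
    change dist (T^[ns k] (f s - p) + T^[ns k] a) (T^[ns k] (f t - p) + T^[ns k] b) ≤ η
    -- Nothing is known about `T^[ns k] p`; adding it to both arguments removes it, leaving four
    -- vectors of size less than `η / 4`.
    rw [← htrans _ _ (T^[ns k] p), iterate_map_sub, iterate_map_sub]
    have e : ∀ u v w : X, u - v + w + v = u + w := fun u v w => by abel
    rw [e, e]
    have := dist_triangle_right (T^[ns k] (f s) + T^[ns k] a) (T^[ns k] (f t) + T^[ns k] b) 0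
    have := dist_add_zero_le htrans (T^[ns k] (f s)) (T^[ns k] a)
    have := dist_add_zero_le htrans (T^[ns k] (f t)) (T^[ns k] b)
    have := h3 a ha
    have := h4 b hb
    linarith
  have hM : ∀ j, ∃ M : ℕ, ∀ s : ℕ → Bool, (∀ i < M, s i = false) → tr (f s - p) (A j) ∈ U j := by
    intro j
    have h0 : ∀ᶠ z in 𝓝 (0 : X), tr z (A j) ∈ U j :=
      (htr (A j)).continuousAt.eventually_mem ((hU j).1.mem_nhds (by rw [htr0]; exact hAU j))
    obtain ⟨r, hr, h⟩ := Metric.eventually_nhds_iff.1 h0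
    obtain ⟨M, hM⟩ := exists_cylinder_dist_lt f hr
    refine ⟨M, fun s hs => h ?_⟩
    rw [← htrans _ _ p]
    simpa using hM s _ hs
  choose M hM using hM
  -- The block index `Nat.pair j (M j)` determines `j`, so blocks are disjoint, and is at least `M
  -- j`, so the translate stays in `U j`.
  let κ : ℕ → (ℕ → Bool) → Y := fun j s => tr (f (blockCode (Nat.pair j (M j)) s) - p) (A j)
  have hcode : ∀ {i j s t}, (i ≠ j ∨ s ≠ t) →
      blockCode (Nat.pair i (M i)) s ≠ blockCode (Nat.pair j (M j)) t := by
    intro i j s t h he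
    obtain ⟨h1, h2⟩ := blockCode_injective he
    rcases h with h | h
    · exact h (Nat.pair_eq_pair.1 h1).1
    · exact h h2
  refine ⟨fun j => range (κ j), fun j => ⟨isCantorSet_range ?_ ?_, ?_⟩, ?_⟩
  · exact (htr (A j)).comp ((f.continuous.comp (continuous_blockCode _)).sub continuous_const)
  · intro s t hst
    by_contra hne
    exact ne_of_le_dist_iterate m hc (hfar j j _ _ (hcode (.inr hne))) hst
  · rintro _ ⟨s, rfl⟩
    exact hM j _ fun i hi => blockCode_of_lt s (hi.trans_le (Nat.right_le_pair _ _))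
  · intro x hx y hy hxy
    obtain ⟨i, s, rfl⟩ := mem_iUnion.1 hx
    obtain ⟨j, t, rfl⟩ := mem_iUnion.1 hy
    have hne : i ≠ j ∨ s ≠ t := by
      by_contra! h
      obtain ⟨rfl, rfl⟩ := h
      exact hxy rfl
    exact isLiYorkePair_of_frequently m (hfar i j _ _ (hcode hne)) (hnear i j _ _ (hcode hne))

/-- A system containing a copy of a hypercyclic operator, with comparable distances, is uniformly
Li-Yorke chaotic. -/
theorem uniformlyLiYorkeChaotic_of_semiconj
    (htrans : ∀ x y z : X, dist (x + z) (y + z) = dist x y)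
    {T : X →L[ℝ] X} (hT : Hypercyclic T) {Y : Type*} (m : MetricSpace Y) {F : Y → Y}
    (hF : Continuous F) (χ : X → Y) (hχ : Function.Semiconj χ T F)
    (hlow : ∀ a b, min 1 (dist a b) ≤ dist (χ a) (χ b))
    (hupp : ∀ a b, dist (χ a) (χ b) ≤ dist a b) :
    UniformlyLiYorkeChaotic m F := by
  obtain ⟨ns, hns, hD⟩ := hT.exists_dense_tendsto_zero
  obtain ⟨v, hv⟩ := exists_ne (0 : X)
  obtain ⟨φ, hφv⟩ := SeparatingDual.exists_ne_zero (R := ℝ) hv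
  have hφ : φ ≠ 0 := by rintro rfl; simp at hφv
  obtain ⟨c, hc, hφc⟩ := exists_modulus htrans φ
  -- Only vectors are compared here, so no corrections are needed.
  obtain ⟨f, hf⟩ := hT.exists_cantor_map hD hφ fun _ _ => 0
  have hc' : 0 < min 1 c := lt_min one_pos hc
  have hfar : ∀ s t, s ≠ t → ∀ N, ∃ n ≥ N, min 1 c ≤ dist (F^[n] (χ (f s))) (F^[n] (χ (f t))) := by
    intro s t hst N
    obtain ⟨n, hn, h⟩ := (hf s t hst).2 0 0 N
    refine ⟨n, hn, ?_⟩
    rw [← (hχ.iterate_right n).eq, ← (hχ.iterate_right n).eq]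
    refine (min_le_min_left 1 ?_).trans (hlow _ _)
    by_contra! hlt
    have := hφc _ _ hlt
    simp only [sub_self, add_zero] at h
    exact lt_asymm h this
  have hnear : ∀ s t, s ≠ t → ∀ η > 0, ∀ N, ∃ n ≥ N,
      dist (F^[n] (χ (f s))) (F^[n] (χ (f t))) ≤ η := by
    intro s t hst η hη N
    obtain ⟨K, hK⟩ := eventually_atTop.1 (hns.eventually (eventually_ge_atTop N))
    obtain ⟨k, hk, h1, h2⟩ := (hf s t hst).1 K (η / 2) (by positivity)
    refine ⟨ns k, hK k hk, ?_⟩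
    rw [← (hχ.iterate_right (ns k)).eq, ← (hχ.iterate_right (ns k)).eq]
    have := dist_triangle_right (T^[ns k] (f s)) (T^[ns k] (f t)) 0
    exact (hupp _ _).trans (by linarith)
  refine ⟨hF, min 1 c, hc', range fun s => χ (f s), ?_, ?_⟩
  · have hi : Function.Injective fun s => χ (f s) := by
      intro s t hst
      by_contra hne
      exact ne_of_le_dist_iterate m hc' (hfar s t hne) hst
    intro hcount
    have : Countable (ℕ → Bool) := by
      have := hcount.to_subtype
      exact (Equiv.ofInjective _ hi).countable_iff.2 this
    have h := Cardinal.mk_le_aleph0 (α := ℕ → Bool)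
    rw [← Cardinal.power_def, Cardinal.mk_bool, Cardinal.mk_nat] at h
    exact (Cardinal.cantor Cardinal.aleph0).not_ge h
  · rintro _ ⟨s, rfl⟩ _ ⟨t, rfl⟩ hne
    have hst : s ≠ t := by rintro rfl; exact hne rfl
    exact isLiYorkePair_of_frequently m (hfar s t hst) (hnear s t hst)

end Translation

/-! ### Hausdorff distance estimates and finite approximation. -/

section Hausdorff

variable {X Z : Type*} [PseudoMetricSpace X] [PseudoMetricSpace Z]

theorem hausdorffDist_image_le {Φ : X → Z} {δ ε : ℝ} (hε : 0 ≤ ε)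
    (hΦ : ∀ u v, dist u v < δ → dist (Φ u) (Φ v) < ε) {A B : Set X}
    (hAB : hausdorffEDist A B ≠ ⊤) (h : hausdorffDist A B < δ) :
    hausdorffDist (Φ '' A) (Φ '' B) ≤ ε := by
  refine hausdorffDist_le_of_mem_dist hε ?_ ?_
  · rintro _ ⟨a, ha, rfl⟩
    obtain ⟨b, hb, hab⟩ := exists_dist_lt_of_hausdorffDist_lt ha h hAB
    exact ⟨Φ b, ⟨b, hb, rfl⟩, (hΦ a b hab).le⟩
  · rintro _ ⟨b, hb, rfl⟩
    obtain ⟨a, ha, hab⟩ := exists_dist_lt_of_hausdorffDist_lt' hb h hAB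
    exact ⟨Φ a, ⟨a, ha, rfl⟩, (hΦ b a (by rwa [dist_comm])).le⟩

theorem hausdorffDist_le_of_forall_dist_le {A B : Set X} (hA : A.Nonempty) (hB : B.Nonempty)
    {η : ℝ} (hη : 0 ≤ η) (h : ∀ a ∈ A, ∀ b ∈ B, dist a b ≤ η) : hausdorffDist A B ≤ η := by
  obtain ⟨a₀, ha₀⟩ := hA
  obtain ⟨b₀, hb₀⟩ := hB
  exact hausdorffDist_le_of_mem_dist hη (fun a ha => ⟨b₀, hb₀, h a ha b₀ hb₀⟩)
    fun b hb => ⟨a₀, ha₀, by rw [dist_comm]; exact h a₀ ha₀ b hb⟩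

theorem hausdorffDist_translate_le {X : Type*} [AddCommGroup X] [MetricSpace X]
    (htrans : ∀ x y z : X, dist (x + z) (y + z) = dist x y) (B : Set X) (z w : X) :
    hausdorffDist ((z + ·) '' B) ((w + ·) '' B) ≤ dist z w := by
  refine hausdorffDist_le_of_mem_dist dist_nonneg ?_ ?_
  · rintro _ ⟨b, hb, rfl⟩
    exact ⟨w + b, ⟨b, hb, rfl⟩, (htrans z w b).le⟩
  · rintro _ ⟨b, hb, rfl⟩
    exact ⟨z + b, ⟨b, hb, rfl⟩, by rw [dist_comm z w]; exact (htrans w z b).le⟩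

/-- A compact set is approximated by finite subsets of a dense set. -/
theorem exists_finite_subset_near {K D : Set X} (hK : IsCompact K) (hD : Dense D) {δ : ℝ}
    (hδ : 0 < δ) : ∃ t : Set X, t.Finite ∧ t ⊆ D ∧ (∀ x ∈ K, ∃ p ∈ t, dist x p < δ) ∧
      ∀ p ∈ t, ∃ x ∈ K, dist x p < δ := by
  -- Only points of `D` already near `K` index the cover, so that the finite subcover is close to
  -- `K` in both directions.
  obtain ⟨t, htD, htf, ht⟩ := hK.elim_finite_subcover_image
    (b := D ∩ {p | ∃ x ∈ K, dist x p < δ}) (c := fun p => ball p δ) (fun _ _ => isOpen_ball)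
    fun x hx => by
      obtain ⟨p, hp, hpD⟩ := Metric.dense_iff.1 hD x δ hδ
      rw [mem_ball, dist_comm] at hp
      exact mem_biUnion (x := p) ⟨hpD, x, hx, hp⟩ hp
  refine ⟨t, htf, fun p hp => (htD hp).1, fun x hx => ?_, fun p hp => (htD hp).2⟩
  obtain ⟨p, hp, hxp⟩ := mem_iUnion₂.1 (ht hx)
  exact ⟨p, hp, hxp⟩

end Hausdorff

/-! ### Chaos on the hyperspace of compact sets. -/

section Compacts

open TopologicalSpace

variable {X : Type*} [AddCommGroup X] [Module ℝ X] [MetricSpace X] [CompleteSpace X]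
  [IsTopologicalAddGroup X] [ContinuousSMul ℝ X] [LocallyConvexSpace ℝ X] [Nontrivial X]

theorem cantorDenselyLiYorkeChaotic_compacts
    (htrans : ∀ x y z : X, dist (x + z) (y + z) = dist x y) {T : X →L[ℝ] X}
    (hT : Hypercyclic T) :
    CantorDenselyLiYorkeChaotic (hausdorffMetric X) (NonemptyCompacts.map T T.continuous) := by
  have hd : ∀ K L : NonemptyCompacts X, dist K L = hausdorffDist (K : Set X) L :=
    fun _ _ => Metric.NonemptyCompacts.dist_eq
  refine cantorDenselyLiYorkeChaotic_of_translation htrans hT _ ?_ (fun K => (K : Set X))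
    (fun z K => K.map (z + ·) (continuous_const_add z)) (fun K => K.isCompact)
    (fun K => K.nonempty) (fun K => rfl) (fun K => ?_) (fun K => ?_) (fun z K => rfl)
    (fun K L => (hd K L).ge) (fun K L η hη h => ?_) (fun D hD U hU hUn => ?_)
  · refine Metric.continuous_iff.2 fun K ε hε => ?_
    obtain ⟨δ, hδ, h⟩ := uniformContinuous_of_translationInvariant htrans T (half_pos hε)
    refine ⟨δ, hδ, fun L hL => ?_⟩
    rw [hd] at hL ⊢
    exact (hausdorffDist_image_le (half_pos hε).le h (hausdorffEDist_ne_top_of_nonempty_of_bounded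
      L.nonempty K.nonempty L.isCompact.isBounded K.isCompact.isBounded) hL).trans_lt
      (half_lt_self hε)
  · refine (LipschitzWith.of_dist_le_mul (K := 1) fun z w => ?_).continuous
    rw [hd, NNReal.coe_one, one_mul]
    exact hausdorffDist_translate_le htrans K z w
  · refine NonemptyCompacts.ext ?_
    change (0 + ·) '' (K : Set X) = K
    simp
  · rw [hd]
    exact hausdorffDist_le_of_forall_dist_le K.nonempty L.nonempty hη h
  · obtain ⟨K, hK⟩ := hUn
    obtain ⟨ε, hε, hball⟩ := Metric.isOpen_iff.1 hU K hK
    obtain ⟨t, htf, htD, h1, h2⟩ := exists_finite_subset_near K.isCompact hD (half_pos hε)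
    obtain ⟨x, hx⟩ := K.nonempty
    obtain ⟨p, hp, -⟩ := h1 x hx
    refine ⟨⟨⟨t, htf.isCompact⟩, ⟨p, hp⟩⟩, hball ?_, htf, htD⟩
    rw [mem_ball, hd]
    refine lt_of_le_of_lt (hausdorffDist_le_of_mem_dist (half_pos hε).le (fun p hp => ?_)
      fun x hx => ?_) (half_lt_self hε)
    · obtain ⟨x, hx, h⟩ := h2 p hp
      exact ⟨x, hx, by rw [dist_comm]; exact h.le⟩
    · obtain ⟨p, hp, h⟩ := h1 x hx
      exact ⟨p, hp, h.le⟩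

end Compacts

namespace FuzzySet

/-! ### Fuzzy sets with finite support. -/

section Finite

variable {X : Type*} [TopologicalSpace X] [T1Space X]

theorem level_zero_of_finite {g : X → I} (hg : {x | 0 < g x}.Finite) :
    level g 0 = {x | 0 < g x} := by
  rw [level_zero, hg.isClosed.closure_eq]

/-- The fuzzy set given by a function with finite support that takes the value `1`. -/
def ofFinite (g : X → I) (hg : {x | 0 < g x}.Finite) (h1 : ∃ x, g x = 1) : FuzzySet X where
  toFun := g
  usc := by
    rw [upperSemicontinuous_iff_isClosed_preimage]
    intro α
    by_cases h : α = 0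
    · have : g ⁻¹' Ici α = univ := by
        rw [h]; exact eq_univ_of_forall fun x => unitInterval.nonneg'
      rw [this]; exact isClosed_univ
    · refine (hg.subset fun x hx => ?_).isClosed
      exact (unitInterval.pos_iff_ne_zero.2 h).trans_le hx
  compact := by rw [level_zero_of_finite hg]; exact hg.isCompact
  normal := by
    obtain ⟨x, hx⟩ := h1
    refine ⟨x, ?_⟩
    rw [level_pos _ one_ne_zero]
    exact hx.ge

open Classical in
/-- The characteristic function of a point. -/
noncomputable def single (a : X) : FuzzySet X :=
  ofFinite (fun x => if x = a then 1 else 0)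
    ((finite_singleton a).subset fun x hx => by
      by_contra h
      have h' : x ≠ a := h
      simp [h'] at hx)
    ⟨a, if_pos rfl⟩

theorem single_self (a : X) : (single a).toFun a = 1 := if_pos rfl

theorem single_of_ne {a x : X} (h : x ≠ a) : (single a).toFun x = 0 := if_neg h

theorem level_single (a : X) (α : I) : level (single a).toFun α = {a} := by
  by_cases h : α = 0
  · have : {x | 0 < (single a).toFun x} = {a} := by
      ext x
      by_cases hx : x = a
      · simp [hx, single_self]
      · simp [hx, single_of_ne hx]
    rw [h, level_zero, this, isClosed_singleton.closure_eq]
  · rw [level_pos _ h]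
    ext x
    by_cases hx : x = a
    · simpa [hx, single_self] using unitInterval.le_one'
    · simp [hx, single_of_ne hx, h]

end Finite

/-! ### Finite approximation of fuzzy sets and comparison of metrics. -/

section Approximation

variable {X : Type*} [MetricSpace X]

open Classical in
/-- Every normal fuzzy set is a `d_∞`-limit of ones supported on finite subsets of a given dense
set. -/
theorem exists_finite_support_distSup_le {D : Set X} (hD : Dense D) (u : FuzzySet X) {δ : ℝ}
    (hδ : 0 < δ) : ∃ v : FuzzySet X, (level v.toFun 0).Finite ∧ level v.toFun 0 ⊆ D ∧
      distSup u v ≤ 2 * δ := by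
  obtain ⟨t, htf, htD, h1, h2⟩ := exists_finite_subset_near u.compact hD hδ
  -- Each `p ∈ t` receives the supremum of `u` within `δ`: this dominates `u` nearby, and when
  -- positive it is attained, so every level of `g` is near the same level of `u`.
  let g : X → I := fun p => if p ∈ t then sSup (u.toFun '' closedBall p δ) else 0
  have hgt : {x | 0 < g x} ⊆ t := by
    intro x hx
    by_contra h
    have : g x = 0 := if_neg h
    exact (lt_irrefl (0 : I)) (this ▸ hx)
  have hle : ∀ p ∈ t, ∀ x, dist x p < δ → u.toFun x ≤ g p := by
    intro p hp x hx
    have : g p = sSup (u.toFun '' closedBall p δ) := if_pos hp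
    rw [this]
    exact le_sSup ⟨x, hx.le, rfl⟩
  have hge : ∀ p, 0 < g p → ∃ x, dist x p ≤ δ ∧ g p ≤ u.toFun x := by
    intro p hp
    have hgp : g p = sSup (u.toFun '' closedBall p δ) := if_pos (hgt hp)
    have hC : IsCompact (level u.toFun 0 ∩ closedBall p δ) :=
      u.compact.inter_right isClosed_closedBall
    have hne : (level u.toFun 0 ∩ closedBall p δ).Nonempty := by
      obtain ⟨x, hx, hxp⟩ := h2 p (hgt hp)
      exact ⟨x, hx, hxp.le⟩
    obtain ⟨z, hz, hmax⟩ := UpperSemicontinuousOn.exists_isMaxOn hne hC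
      (u.usc.upperSemicontinuousOn _)
    refine ⟨z, hz.2, ?_⟩
    rw [hgp]
    refine sSup_le ?_
    rintro _ ⟨w, hw, rfl⟩
    by_cases hw0 : u.toFun w = 0
    · rw [hw0]; exact unitInterval.nonneg'
    · exact hmax ⟨mem_level_zero (unitInterval.pos_iff_ne_zero.2 hw0), hw⟩
  have hgf : {x | 0 < g x}.Finite := htf.subset hgt
  have hg1 : ∃ x, g x = 1 := by
    obtain ⟨x, hx⟩ := u.exists_eq_one
    obtain ⟨p, hp, hxp⟩ := h1 x (mem_level_zero (by rw [hx]; exact zero_lt_one))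
    exact ⟨p, le_antisymm unitInterval.le_one' (hx ▸ hle p hp x hxp)⟩
  have hl0 : level g 0 = {x | 0 < g x} := level_zero_of_finite hgf
  refine ⟨ofFinite g hgf hg1, ?_, ?_, ciSup_le fun α => hausdorffDist_le_of_mem_dist
    (by positivity) ?_ ?_⟩
  · change (level g 0).Finite
    rw [hl0]; exact hgf
  · change level g 0 ⊆ D
    rw [hl0]; exact hgt.trans htD
  · change ∀ x ∈ level u.toFun α, ∃ y ∈ level g α, dist x y ≤ 2 * δ
    intro x hx
    -- The 0-level is a closure, so a point of it must first be moved to a point of positive grade;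
    -- this costs the second `δ`.
    by_cases hα : α = 0
    · subst hα
      rw [hl0]
      rw [level_zero] at hx
      obtain ⟨y, hy, hxy⟩ := Metric.mem_closure_iff.1 hx δ hδ
      obtain ⟨p, hp, hyp⟩ := h1 y (mem_level_zero hy)
      refine ⟨p, lt_of_lt_of_le hy (hle p hp y hyp), ?_⟩
      linarith [dist_triangle x y p]
    · obtain ⟨p, hp, hxp⟩ := h1 x (level_subset _ α hx)
      rw [level_pos _ hα] at hx ⊢
      exact ⟨p, le_trans hx (hle p hp x hxp), by linarith⟩
  · change ∀ p ∈ level g α, ∃ x ∈ level u.toFun α, dist p x ≤ 2 * δ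
    intro p hp
    have hp0 : 0 < g p := by
      have := level_subset g α hp
      rwa [hl0] at this
    obtain ⟨x, hxp, hx⟩ := hge p hp0
    refine ⟨x, ?_, by rw [dist_comm]; linarith⟩
    by_cases hα : α = 0
    · subst hα
      exact mem_level_zero (hp0.trans_le hx)
    · rw [level_pos _ hα] at hp ⊢
      exact le_trans hp hx

theorem distSup_le_of_forall_dist_le {u v : FuzzySet X} {η : ℝ} (hη : 0 ≤ η)
    (h : ∀ a ∈ level u.toFun 0, ∀ b ∈ level v.toFun 0, dist a b ≤ η) : distSup u v ≤ η :=
  ciSup_le fun α => hausdorffDist_le_of_forall_dist_le (u.level_nonempty α) (v.level_nonempty α) hη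
    fun a ha b hb => h a (level_subset _ α ha) b (level_subset _ α hb)

theorem distSkorokhod_le_distSup (u v : FuzzySet X) : distSkorokhod u v ≤ distSup u v := by
  refine le_of_forall_pos_le_add fun ε hε => ?_
  have hn := distSup_nonneg u v
  have e : reparam (OrderIso.refl I) v = v := ext_fun rfl
  refine distSkorokhod_le (by linarith) (OrderIso.refl I) (fun α => ?_) (by rw [e]; linarith)
  simp only [OrderIso.refl_apply, sub_self, abs_zero]
  linarith

/-- A reparametrization fixes 0, hence does not change the 0-level. -/
theorem hausdorffDist_level_zero_le_distSkorokhod (u v : FuzzySet X) :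
    hausdorffDist (level u.toFun 0) (level v.toFun 0) ≤ distSkorokhod u v := by
  refine le_of_forall_pos_le_add fun ε hε => ?_
  obtain ⟨ξ, -, h⟩ := exists_of_distSkorokhod_lt (lt_add_of_pos_right (distSkorokhod u v) hε)
  have h0 := (le_distSup u (reparam ξ v) 0).trans h
  have : ξ.symm 0 = 0 := ξ.symm.map_bot
  rwa [reparam, level_comp, this] at h0

end Approximation

/-! ### Continuity of the Zadeh extension in the four metrics. -/

section ZadehContinuity

variable {X : Type*} [MetricSpace X] {f : X → X} (hf : Continuous f)

/-- Lets the same `ξ` compare the images as compares the originals in the Skorokhod metric. -/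
theorem zadeh_reparam (ξ : I ≃o I) (u : FuzzySet X) :
    zadeh f hf (reparam ξ u) = reparam ξ (zadeh f hf u) := by
  refine eq_of_level fun α => ?_
  change level (zadehFun f (reparam ξ u).toFun) α = level (ξ ∘ zadehFun f u.toFun) α
  rw [level_comp, level_zadehFun hf, level_zadehFun hf]
  exact congrArg (f '' ·) (level_comp ξ u.toFun α)

theorem distSup_zadeh_le {δ ε : ℝ} (hε : 0 ≤ ε)
    (hfu : ∀ x y, dist x y < δ → dist (f x) (f y) < ε) {u v : FuzzySet X}
    (h : distSup u v < δ) : distSup (zadeh f hf u) (zadeh f hf v) ≤ ε := by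
  refine ciSup_le fun α => ?_
  change hausdorffDist (level (zadehFun f u.toFun) α) (level (zadehFun f v.toFun) α) ≤ ε
  rw [level_zadehFun hf, level_zadehFun hf]
  exact hausdorffDist_image_le hε hfu (level_edist_ne_top u v α α) ((le_distSup u v α).trans_lt h)

theorem continuous_zadeh_supMetric
    (hfu : ∀ ε > 0, ∃ δ > 0, ∀ x y, dist x y < δ → dist (f x) (f y) < ε) :
    letI := supMetric X
    Continuous (zadeh f hf) := by
  let := supMetric X
  refine Metric.continuous_iff.2 fun u ε hε => ?_
  obtain ⟨δ, hδ, h⟩ := hfu (ε / 2) (half_pos hε)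
  exact ⟨δ, hδ, fun v hv => (distSup_zadeh_le hf (half_pos hε).le h hv).trans_lt (half_lt_self hε)⟩

theorem continuous_zadeh_skorokhodMetric
    (hfu : ∀ ε > 0, ∃ δ > 0, ∀ x y, dist x y < δ → dist (f x) (f y) < ε) :
    letI := skorokhodMetric X
    Continuous (zadeh f hf) := by
  let := skorokhodMetric X
  refine Metric.continuous_iff.2 fun u ε hε => ?_
  obtain ⟨δ, hδ, h⟩ := hfu (ε / 2) (half_pos hε)
  refine ⟨min (δ / 2) (ε / 2), lt_min (half_pos hδ) (half_pos hε), fun v hv => ?_⟩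
  obtain ⟨ξ, h1, h2⟩ := exists_of_distSkorokhod_lt hv
  refine lt_of_le_of_lt (distSkorokhod_le (half_pos hε) ξ
    (fun α => (h1 α).trans (min_le_right _ _)) ?_) (half_lt_self hε)
  rw [← zadeh_reparam]
  exact distSup_zadeh_le hf (half_pos hε).le h
    ((h2.trans (min_le_left _ _)).trans_lt (half_lt_self hδ))

/-- For positive heights the supremum over the fibre is attained, by compactness of the support. At
height 0 the conclusion fails off the range of `f`. -/
theorem exists_of_mem_endograph_zadeh {u : FuzzySet X} {y : X} {α : I} (hα : α ≠ 0)
    (h : (y, α) ∈ endograph (zadeh f hf u).toFun) :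
    ∃ x, f x = y ∧ (x, α) ∈ endograph u.toFun := by
  have h' : y ∈ level (zadehFun f u.toFun) α := by rw [level_pos _ hα]; exact h
  rw [level_zadehFun hf, level_pos _ hα] at h'
  obtain ⟨x, hx, hxy⟩ := h'
  exact ⟨x, hxy, hx⟩

theorem mem_endograph_zadeh {u : FuzzySet X} {x : X} {α : I}
    (h : (x, α) ∈ endograph u.toFun) : (f x, α) ∈ endograph (zadeh f hf u).toFun :=
  le_trans (α := I) h (le_sSup ⟨x, rfl, rfl⟩)

theorem sendograph_zadeh (u : FuzzySet X) :
    sendograph (zadeh f hf u).toFun = Prod.map f id '' sendograph u.toFun := by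
  have h0 : level (zadeh f hf u).toFun 0 = f '' level u.toFun 0 := level_zadehFun hf u 0
  ext ⟨y, α⟩
  constructor
  · rintro ⟨h1, h2, -⟩
    by_cases hα : α = 0
    · change y ∈ level (zadeh f hf u).toFun 0 at h2
      rw [h0] at h2
      obtain ⟨x, hx, rfl⟩ := h2
      subst hα
      exact ⟨(x, 0), ⟨unitInterval.nonneg', hx, mem_univ _⟩, rfl⟩
    · obtain ⟨x, rfl, hx⟩ := exists_of_mem_endograph_zadeh hf hα h1
      exact ⟨(x, α), ⟨hx, mem_level_zero
        (lt_of_lt_of_le (unitInterval.pos_iff_ne_zero.2 hα) hx), mem_univ _⟩, rfl⟩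
  · rintro ⟨⟨x, β⟩, ⟨h1, h2, -⟩, he⟩
    obtain ⟨rfl, rfl⟩ := Prod.mk.inj he
    refine ⟨mem_endograph_zadeh hf h1, ?_, mem_univ _⟩
    change f x ∈ level (zadeh f hf u).toFun 0
    rw [h0]
    exact ⟨x, h2, rfl⟩

/-- The grade coordinate is not moved by `f`, whence the requirement `δ ≤ ε`. -/
theorem dist_prodMap_id_lt {δ ε : ℝ} (hδε : δ ≤ ε)
    (hfu : ∀ x y, dist x y < δ → dist (f x) (f y) < ε) (p q : X × I) (h : dist p q < δ) :
    dist (Prod.map f id p) (Prod.map f id q) < ε := by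
  rw [Prod.dist_eq] at h ⊢
  exact max_lt (hfu _ _ ((le_max_left _ _).trans_lt h))
    (((le_max_right _ _).trans_lt h).trans_le hδε)

theorem continuous_zadeh_sendographMetric
    (hfu : ∀ ε > 0, ∃ δ > 0, ∀ x y, dist x y < δ → dist (f x) (f y) < ε) :
    letI := sendographMetric X
    Continuous (zadeh f hf) := by
  let := sendographMetric X
  refine Metric.continuous_iff.2 fun u ε hε => ?_
  obtain ⟨δ, hδ, h⟩ := hfu (ε / 2) (half_pos hε)
  refine ⟨min δ (ε / 2), lt_min hδ (half_pos hε), fun v hv => ?_⟩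
  refine lt_of_le_of_lt ?_ (half_lt_self hε)
  change hausdorffDist (sendograph _) (sendograph _) ≤ _
  rw [sendograph_zadeh, sendograph_zadeh]
  exact hausdorffDist_image_le (half_pos hε).le (dist_prodMap_id_lt (min_le_right δ (ε / 2))
    fun x y hxy => h x y (hxy.trans_le (min_le_left _ _))) (send_edist_ne_top v u) hv

theorem exists_endograph_zadeh_dist_le {δ ε : ℝ} (hε : 0 ≤ ε) (hδε : δ ≤ ε)
    (hfu : ∀ x y, dist x y < δ → dist (f x) (f y) < ε) {u v : FuzzySet X}
    (h : distEnd u v < δ) (p : X × I) (hp : p ∈ endograph (zadeh f hf u).toFun) :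
    ∃ q ∈ endograph (zadeh f hf v).toFun, dist p q ≤ ε := by
  obtain ⟨y, α⟩ := p
  -- Every endograph contains all of `X × {0}`, so a point at height 0 is its own partner; only
  -- positive heights need a preimage.
  by_cases hα : α = 0
  · subst hα
    exact ⟨(y, 0), unitInterval.nonneg', by rwa [dist_self]⟩
  · obtain ⟨x, rfl, hx⟩ := exists_of_mem_endograph_zadeh hf hα hp
    obtain ⟨⟨z, β⟩, hz, hd⟩ := exists_dist_lt_of_hausdorffDist_lt hx h (end_edist_ne_top u v)
    exact ⟨(f z, β), mem_endograph_zadeh hf hz, (dist_prodMap_id_lt hδε hfu _ _ hd).le⟩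

theorem continuous_zadeh_endographMetric
    (hfu : ∀ ε > 0, ∃ δ > 0, ∀ x y, dist x y < δ → dist (f x) (f y) < ε) :
    letI := endographMetric X
    Continuous (zadeh f hf) := by
  let := endographMetric X
  refine Metric.continuous_iff.2 fun u ε hε => ?_
  obtain ⟨δ, hδ, h⟩ := hfu (ε / 2) (half_pos hε)
  refine ⟨min δ (ε / 2), lt_min hδ (half_pos hε), fun v hv => ?_⟩
  refine lt_of_le_of_lt ?_ (half_lt_self hε)
  have h' : ∀ x y, dist x y < min δ (ε / 2) → dist (f x) (f y) < ε / 2 :=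
    fun x y hxy => h x y (hxy.trans_le (min_le_left _ _))
  have hv' : distEnd v u < min δ (ε / 2) := hv
  have hv'' : distEnd u v < min δ (ε / 2) := by rwa [distEnd, hausdorffDist_comm]
  exact hausdorffDist_le_of_mem_dist (half_pos hε).le
    (exists_endograph_zadeh_dist_le hf (half_pos hε).le (min_le_right _ _) h' hv')
    (exists_endograph_zadeh_dist_le hf (half_pos hε).le (min_le_right _ _) h' hv'')

theorem zadeh_single (a : X) : zadeh f hf (single a) = single (f a) := by
  refine eq_of_level fun α => ?_
  change level (zadehFun f (single a).toFun) α = _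
  rw [level_zadehFun hf, level_single, level_single, image_singleton]

end ZadehContinuity

/-! ### Characteristic functions of points in the graph metrics. -/

section Single

variable {X : Type*} [MetricSpace X]

/-- From the peak `(a, 1)` one reaches the endograph either over `b`, at horizontal distance `dist a
b`, or at height 0, at vertical distance 1. -/
theorem min_one_dist_le_dist_of_mem_endograph_single {a b : X} {q : X × I}
    (hq : q ∈ endograph (single b).toFun) : min 1 (dist a b) ≤ dist ((a, 1) : X × I) q := by
  obtain ⟨y, β⟩ := q
  rw [Prod.dist_eq]
  by_cases hy : y = b
  · subst hy
    exact (min_le_right _ _).trans (le_max_left _ _)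
  · have hβ : β ≤ (single b).toFun y := hq
    rw [single_of_ne hy] at hβ
    have hβ0 : β = 0 := le_antisymm hβ unitInterval.nonneg'
    subst hβ0
    refine (min_le_left _ _).trans (le_max_of_le_right ?_)
    simp [Subtype.dist_eq]

theorem min_one_dist_le_distEnd_single (a b : X) :
    min 1 (dist a b) ≤ distEnd (single a) (single b) := by
  by_contra! h
  have ha : ((a, 1) : X × I) ∈ endograph (single a).toFun := (single_self a).ge
  obtain ⟨q, hq, hd⟩ := exists_dist_lt_of_hausdorffDist_lt ha h (end_edist_ne_top _ _)
  exact hd.not_ge (min_one_dist_le_dist_of_mem_endograph_single hq)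

theorem min_one_dist_le_distSend_single (a b : X) :
    min 1 (dist a b) ≤ distSend (single a) (single b) := by
  by_contra! h
  have ha : ((a, 1) : X × I) ∈ sendograph (single a).toFun :=
    ⟨(single_self a).ge, by rw [level_single]; exact rfl, mem_univ _⟩
  obtain ⟨q, hq, hd⟩ := exists_dist_lt_of_hausdorffDist_lt ha h (send_edist_ne_top _ _)
  exact hd.not_ge (min_one_dist_le_dist_of_mem_endograph_single hq.1)

theorem distEnd_single_le (a b : X) : distEnd (single a) (single b) ≤ dist a b := by
  have key : ∀ a b : X, ∀ p ∈ endograph (single a).toFun,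
      ∃ q ∈ endograph (single b).toFun, dist p q ≤ dist a b := by
    rintro a b ⟨x, α⟩ hp
    by_cases hx : x = a
    · subst hx
      refine ⟨(b, α), ?_, by simp [Prod.dist_eq]⟩
      change α ≤ (single b).toFun b
      rw [single_self]; exact unitInterval.le_one'
    · refine ⟨(x, α), ?_, by simp⟩
      have hα : α ≤ (single a).toFun x := hp
      rw [single_of_ne hx] at hα
      exact hα.trans unitInterval.nonneg'
  exact hausdorffDist_le_of_mem_dist dist_nonneg (key a b) (dist_comm a b ▸ key b a)

theorem distSend_single_le (a b : X) : distSend (single a) (single b) ≤ dist a b := by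
  have key : ∀ a b : X, ∀ p ∈ sendograph (single a).toFun,
      ∃ q ∈ sendograph (single b).toFun, dist p q ≤ dist a b := by
    rintro a b ⟨x, α⟩ ⟨-, hx, -⟩
    have hx' : x = a := by
      rw [level_single] at hx
      exact hx
    subst hx'
    refine ⟨(b, α), ⟨?_, ?_, mem_univ _⟩, by simp [Prod.dist_eq]⟩
    · change α ≤ (single b).toFun b
      rw [single_self]; exact unitInterval.le_one'
    · rw [level_single]; exact rfl
  exact hausdorffDist_le_of_mem_dist dist_nonneg (key a b) (dist_comm a b ▸ key b a)

end Single

/-! ### Chaos of the Zadeh extension. -/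

section Chaos

variable {X : Type*} [AddCommGroup X] [Module ℝ X] [MetricSpace X] [CompleteSpace X]
  [IsTopologicalAddGroup X] [ContinuousSMul ℝ X] [LocallyConvexSpace ℝ X] [Nontrivial X]

/-- Translation of a fuzzy set by a vector. -/
noncomputable def translate {X : Type*} [AddCommGroup X] [MetricSpace X] [IsTopologicalAddGroup X]
    (z : X) (u : FuzzySet X) : FuzzySet X :=
  zadeh (z + ·) (continuous_const_add z) u

theorem level_translate {X : Type*} [AddCommGroup X] [MetricSpace X] [IsTopologicalAddGroup X]
    (z : X) (u : FuzzySet X) (α : I) :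
    level (translate z u).toFun α = (z + ·) '' level u.toFun α :=
  level_zadehFun (continuous_const_add z) u α

theorem translate_zero {X : Type*} [AddCommGroup X] [MetricSpace X] [IsTopologicalAddGroup X]
    (u : FuzzySet X) : translate 0 u = u :=
  eq_of_level fun α => by rw [level_translate]; simp

theorem distSup_translate_le {X : Type*} [AddCommGroup X] [MetricSpace X] [IsTopologicalAddGroup X]
    (htrans : ∀ x y z : X, dist (x + z) (y + z) = dist x y) (u : FuzzySet X) (z w : X) :
    distSup (translate z u) (translate w u) ≤ dist z w :=
  ciSup_le fun α => by
    rw [level_translate, level_translate]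
    exact hausdorffDist_translate_le htrans _ z w

/-- A metric between the Hausdorff distance of the supports and `d_∞` makes the Zadeh extension of a
hypercyclic operator Cantor-densely Li-Yorke chaotic, if it makes it continuous. -/
theorem cantorDenselyLiYorkeChaotic_zadeh
    (htrans : ∀ x y z : X, dist (x + z) (y + z) = dist x y) {T : X →L[ℝ] X}
    (hT : Hypercyclic T) (m : MetricSpace (FuzzySet X))
    (hc : Continuous (zadeh T T.continuous))
    (hlow : ∀ u v : FuzzySet X, hausdorffDist (level u.toFun 0) (level v.toFun 0) ≤ dist u v)
    (hupp : ∀ u v : FuzzySet X, dist u v ≤ distSup u v) :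
    CantorDenselyLiYorkeChaotic m (zadeh T T.continuous) := by
  refine cantorDenselyLiYorkeChaotic_of_translation htrans hT m hc (fun u => level u.toFun 0)
    translate (fun u => u.compact) (fun u => u.level_nonempty 0)
    (fun u => level_zadehFun T.continuous u 0) (fun u => ?_) translate_zero
    (fun z u => level_translate z u 0) hlow
    (fun u v η hη h => (hupp u v).trans (distSup_le_of_forall_dist_le hη h))
    (fun D hD U hU hUn => ?_)
  · refine (LipschitzWith.of_dist_le_mul (K := 1) fun z w => ?_).continuous
    rw [NNReal.coe_one, one_mul]
    exact (hupp _ _).trans (distSup_translate_le htrans u z w)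
  · obtain ⟨u, hu⟩ := hUn
    obtain ⟨ε, hε, hball⟩ := Metric.isOpen_iff.1 hU u hu
    obtain ⟨v, hvf, hvD, hv⟩ := exists_finite_support_distSup_le hD u
      (show 0 < ε / 4 by positivity)
    refine ⟨v, hball ?_, hvf, hvD⟩
    rw [mem_ball, dist_comm]
    have := hupp u v
    linarith

end Chaos

end FuzzySet

end FuzzyChaos

theorem mainTheorem10 {𝕜 : Type*} [RCLike 𝕜] {X : Type*} [AddCommGroup X] [Module 𝕜 X]
    [Module ℝ X] [IsScalarTower ℝ 𝕜 X] [MetricSpace X] [CompleteSpace X]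
    [IsTopologicalAddGroup X] [ContinuousSMul 𝕜 X] [LocallyConvexSpace ℝ X] [Nontrivial X]
    (htrans : ∀ x y z : X, dist (x + z) (y + z) = dist x y)
    (T : X →L[𝕜] X) (hT : FuzzyChaos.Hypercyclic T) :
    FuzzyChaos.CantorDenselyLiYorkeChaotic (FuzzyChaos.hausdorffMetric X)
        (TopologicalSpace.NonemptyCompacts.map T T.continuous) ∧
      FuzzyChaos.CantorDenselyLiYorkeChaotic (FuzzyChaos.FuzzySet.supMetric X)
        (FuzzyChaos.FuzzySet.zadeh T T.continuous) ∧
      FuzzyChaos.CantorDenselyLiYorkeChaotic (FuzzyChaos.FuzzySet.skorokhodMetric X)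
        (FuzzyChaos.FuzzySet.zadeh T T.continuous) ∧
      FuzzyChaos.UniformlyLiYorkeChaotic (FuzzyChaos.FuzzySet.sendographMetric X)
        (FuzzyChaos.FuzzySet.zadeh T T.continuous) ∧
      FuzzyChaos.UniformlyLiYorkeChaotic (FuzzyChaos.FuzzySet.endographMetric X)
        (FuzzyChaos.FuzzySet.zadeh T T.continuous) := by
  have : ContinuousSMul ℝ X := IsScalarTower.continuousSMul (M := ℝ) (α := X) 𝕜
  -- Only the real structure matters: `T` and its restriction of scalars are the same map, with the
  -- same orbits and Zadeh extension.
  let S : X →L[ℝ] X := T.restrictScalars ℝ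
  have hS : FuzzyChaos.Hypercyclic S := hT
  have hu : ∀ ε > 0, ∃ δ > 0, ∀ x y, dist x y < δ → dist (S x) (S y) < ε := fun _ hε =>
    FuzzyChaos.uniformContinuous_of_translationInvariant htrans S hε
  refine ⟨FuzzyChaos.cantorDenselyLiYorkeChaotic_compacts htrans hS, ?_, ?_, ?_, ?_⟩
  · exact FuzzyChaos.FuzzySet.cantorDenselyLiYorkeChaotic_zadeh htrans hS _
      (FuzzyChaos.FuzzySet.continuous_zadeh_supMetric _ hu)
      (fun u v => FuzzyChaos.FuzzySet.le_distSup u v 0) fun _ _ => le_rfl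
  · exact FuzzyChaos.FuzzySet.cantorDenselyLiYorkeChaotic_zadeh htrans hS _
      (FuzzyChaos.FuzzySet.continuous_zadeh_skorokhodMetric _ hu)
      FuzzyChaos.FuzzySet.hausdorffDist_level_zero_le_distSkorokhod
      FuzzyChaos.FuzzySet.distSkorokhod_le_distSup
  · exact FuzzyChaos.uniformlyLiYorkeChaotic_of_semiconj htrans hS _
      (FuzzyChaos.FuzzySet.continuous_zadeh_sendographMetric _ hu) FuzzyChaos.FuzzySet.single
      (fun a => (FuzzyChaos.FuzzySet.zadeh_single S.continuous a).symm)
      FuzzyChaos.FuzzySet.min_one_dist_le_distSend_single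
      FuzzyChaos.FuzzySet.distSend_single_le
  · exact FuzzyChaos.uniformlyLiYorkeChaotic_of_semiconj htrans hS _
      (FuzzyChaos.FuzzySet.continuous_zadeh_endographMetric _ hu) FuzzyChaos.FuzzySet.single
      (fun a => (FuzzyChaos.FuzzySet.zadeh_single S.continuous a).symm)
      FuzzyChaos.FuzzySet.min_one_dist_le_distEnd_single
      FuzzyChaos.FuzzySet.distEnd_single_le
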